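/- Let $\mathscr S(\mathbb R^n)$ be the Schwartz space of complex-valued functions and $\mathscr S'(\mathbb R^n)$ its dual (the tempered distributions) with the weak-$*$ topology. Let $\mathscr F$ be the Fourier transform, $\mathscr F\varphi(\xi)=\int_{\mathbb R^n}e^{-ix\cdot\xi}\varphi(x)\,dx$ on $\mathscr S(\mathbb R^n)$, extended to $\mathscr S'(\mathbb R^n)$ by duality. Put $\langle\xi\rangle=(1+|\xi|^2)^{1/2}$ and $n^+=[n/2]+1$. Let $\mathcal K$ be the class of measurable functions $\chi:\mathbb R^n\to(0,\infty)$ for which there are constants $C,\ell>0$ with $\chi(\xi+\eta)\le C(1+|\xi|)^{\ell}\chi(\eta)$ for all $\xi,\eta\in\mathbb R^n$. Let $\mathcal K_1$ be the class of those $\chi\in\mathcal K\cap C^{2n^+}(\mathbb R^n)$ for which there are constants $C_\chi,\ell_\chi>0$ with $$|D^\alpha\chi(\xi)|\le C_\chi\langle\xi\rangle^{\ell_\chi}\qquad(\xi\in\mathbb R^n,\ |\alpha|\le 2n^+).\tag{$*$}$$ Let $\mathcal K_0$ be the class of those $\chi\in\mathcal K\cap C^\infty(\mathbb R^n)$ for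 which $\chi^{-1}\in\mathcal K$, $\chi\varphi\in\mathscr S(\mathbb R^n)$ for all $\varphi\in\mathscr S(\mathbb R^n)$, and $(*)$ holds for some $C_\chi,\ell_\chi>0$. Let $1<p<\infty$, and let $\chi\in\mathcal K_1$ if $p\le 2$ and $\chi\in\mathcal K_0$ if $p>2$. If $p\le2$, let $H^\chi_p(\mathbb R^n)$ be the set of all $u\in\mathscr S'(\mathbb R^n)$ such that $\mathscr Fu$ is a measurable function, the function $\chi\mathscr Fu$ is a tempered distribution, and $\mathscr F^{-1}\chi\mathscr Fu\in L_p(\mathbb R^n)$. (Here a tempered distribution $T$ is a measurable function $f$ if, for every $\varphi\in\mathscr S(\mathbb R^n)$, $f\varphi$ is integrable and $T(\varphi)=\int f\varphi\,dx$.) If $p>2$, let $H^\chi_p(\mathbb R^n)$ be the set of all $u\in\mathscr S'(\mathbb R^n)$ such that $\mathscr F^{-1}\chi\mathscr Fu\in L_p(\mathbb R^n)$, where $(\chi T)(\varphi)=T(\chi\varphi)$ for $T\in\mathscr S'(\mathbb R^n)$ and $\varphi\in\mathscr S(\mathbb R^n)$. In both cases $H^\chi_p(\mathbb R^n)$ is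 equipped with the norm $\|u\|=\|\mathscr F^{-1}\chi\mathscr Fu\|_{L_p(\mathbb R^n)}$. **Proposition.** $\mathscr S(\mathbb R^n)\subset H^\chi_p(\mathbb R^n)\subset\mathscr S'(\mathbb R^n)$, where $\varphi\in\mathscr S(\mathbb R^n)$ is identified with the distribution $\psi\mapsto\int\varphi\psi\,dx$, and both inclusions are continuous. Moreover, $\mathscr S(\mathbb R^n)$ is dense in $H^\chi_p(\mathbb R^n)$. -/

import Mathlib

open MeasureTheory FourierTransform
open scoped SchwartzMap ENNReal ContDiff

noncomputable section

namespace GenSobolev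

/-- `ℝⁿ` with its Euclidean norm. -/
abbrev Rn (n : ℕ) : Type := EuclideanSpace ℝ (Fin n)

variable {n : ℕ}

/-! ### The Fourier transform with kernel `exp (-i x·ξ)` -/

/-- The dilation `x ↦ c x` of `ℝⁿ`, for `c ≠ 0`. -/
def dilation (n : ℕ) (c : ℝ) (hc : c ≠ 0) : Rn n ≃L[ℝ] Rn n :=
  ContinuousLinearEquiv.smulLeft (Units.mk0 c hc)

theorem two_pi_ne_zero : (2 * Real.pi : ℝ) ≠ 0 := by positivity

/-- The Fourier transform `(F φ)(ξ) = ∫ exp (-i x·ξ) φ(x) dx` on the Schwartz space. Mathlib's `𝓕`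
has the kernel `exp (-2 π i x·ξ)`, so `(F φ)(ξ) = (𝓕 φ)(ξ / 2π)`. -/
def fourierS (n : ℕ) : 𝓢(Rn n, ℂ) →L[ℂ] 𝓢(Rn n, ℂ) :=
  (SchwartzMap.compCLMOfContinuousLinearEquiv ℂ
    (dilation n (2 * Real.pi)⁻¹ (inv_ne_zero two_pi_ne_zero))) ∘L (fourierCLM ℂ 𝓢(Rn n, ℂ))

/-- The inverse of `fourierS`. -/
def fourierInvS (n : ℕ) : 𝓢(Rn n, ℂ) →L[ℂ] 𝓢(Rn n, ℂ) :=
  (fourierInvCLM ℂ 𝓢(Rn n, ℂ)) ∘L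
    (SchwartzMap.compCLMOfContinuousLinearEquiv ℂ (dilation n (2 * Real.pi) two_pi_ne_zero))

theorem fourierS_apply (φ : 𝓢(Rn n, ℂ)) (ξ : Rn n) :
    fourierS n φ ξ = ∫ x, Complex.exp (-(Complex.I * (inner ℝ x ξ : ℝ))) * φ x := by
  have h : fourierS n φ ξ = (𝓕 φ : 𝓢(Rn n, ℂ)) ((2 * Real.pi)⁻¹ • ξ) := rfl
  rw [h, SchwartzMap.fourier_coe, Real.fourier_eq']
  congr 1
  ext x
  rw [smul_eq_mul, inner_smul_right]
  congr 2
  have : (Real.pi : ℂ) ≠ 0 := by exact_mod_cast Real.pi_ne_zero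
  push_cast
  field_simp

theorem fourierInvS_fourierS (φ : 𝓢(Rn n, ℂ)) : fourierInvS n (fourierS n φ) = φ := by
  have h : SchwartzMap.compCLMOfContinuousLinearEquiv ℂ (dilation n (2 * Real.pi) two_pi_ne_zero)
      (fourierS n φ) = (𝓕 φ : 𝓢(Rn n, ℂ)) := by
    ext ξ
    change (𝓕 φ : 𝓢(Rn n, ℂ)) ((2 * Real.pi)⁻¹ • ((2 * Real.pi) • ξ)) = _
    rw [smul_smul, inv_mul_cancel₀ two_pi_ne_zero, one_smul]
  change 𝓕⁻ (SchwartzMap.compCLMOfContinuousLinearEquiv ℂ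
    (dilation n (2 * Real.pi) two_pi_ne_zero) (fourierS n φ)) = φ
  rw [h, fourierInv_fourier_eq]

theorem fourierS_fourierInvS (φ : 𝓢(Rn n, ℂ)) : fourierS n (fourierInvS n φ) = φ := by
  have h : (𝓕 (fourierInvS n φ) : 𝓢(Rn n, ℂ)) = SchwartzMap.compCLMOfContinuousLinearEquiv ℂ
      (dilation n (2 * Real.pi) two_pi_ne_zero) φ := fourier_fourierInv_eq _
  ext ξ
  change (𝓕 (fourierInvS n φ) : 𝓢(Rn n, ℂ)) ((2 * Real.pi)⁻¹ • ξ) = φ ξ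
  rw [h]
  change φ ((2 * Real.pi) • ((2 * Real.pi)⁻¹ • ξ)) = φ ξ
  rw [smul_smul, mul_inv_cancel₀ two_pi_ne_zero, one_smul]

/-- The Fourier transform on tempered distributions, `(F u)(φ) = u(F φ)`. Here `𝓢'(Rn n, ℂ)` is
the space of continuous linear functionals on `𝓢(Rn n, ℂ)` with the weak-* topology. -/
def fourierD (n : ℕ) : 𝓢'(Rn n, ℂ) →L[ℂ] 𝓢'(Rn n, ℂ) :=
  PointwiseConvergenceCLM.precomp ℂ (fourierS n)

/-- The inverse Fourier transform on tempered distributions, `(F⁻¹ u)(φ) = u(F⁻¹ φ)`. -/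
def fourierInvD (n : ℕ) : 𝓢'(Rn n, ℂ) →L[ℂ] 𝓢'(Rn n, ℂ) :=
  PointwiseConvergenceCLM.precomp ℂ (fourierInvS n)

@[simp]
theorem fourierD_apply (u : 𝓢'(Rn n, ℂ)) (φ : 𝓢(Rn n, ℂ)) :
    fourierD n u φ = u (fourierS n φ) := rfl

@[simp]
theorem fourierInvD_apply (u : 𝓢'(Rn n, ℂ)) (φ : 𝓢(Rn n, ℂ)) :
    fourierInvD n u φ = u (fourierInvS n φ) := rfl

/-! ### Weight functions -/

/-- The class `𝒦` of weight functions. -/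
structure MemK (χ : Rn n → ℝ) : Prop where
  measurable : Measurable χ
  pos : ∀ ξ, 0 < χ ξ
  exists_bound : ∃ C > 0, ∃ l : ℝ, 0 < l ∧
    ∀ ξ η, χ (ξ + η) ≤ C * (1 + ‖ξ‖) ^ l * χ η

/-- `t⁺ = [t/2] + 1`. -/
def plus (t : ℕ) : ℕ := t / 2 + 1

/-- The derivatives of `χ` up to order `2n⁺` are bounded by `C ⟨ξ⟩ ^ l`, where
`⟨ξ⟩ = (1 + |ξ|²) ^ (1/2)`. -/
def DerivBound (χ : Rn n → ℝ) : Prop :=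
  ∃ C > 0, ∃ l : ℝ, 0 < l ∧ ∀ k ≤ 2 * plus n, ∀ ξ,
    ‖iteratedFDeriv ℝ k χ ξ‖ ≤ C * (Real.sqrt (1 + ‖ξ‖ ^ 2)) ^ l

/-- The class `𝒦₁`: members of `𝒦` of class `C^{2n⁺}` whose derivatives up to that order have
polynomial growth. -/
structure MemK₁ (χ : Rn n → ℝ) : Prop extends MemK χ where
  contDiff : ContDiff ℝ (2 * plus n : ℕ) χ
  derivBound : DerivBound χ

/-- `χ` is a multiplier on the Schwartz space: multiplication by `χ` maps `𝓢(Rn n, ℂ)` into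
itself. -/
def IsSchwartzMultiplier (χ : Rn n → ℝ) : Prop :=
  ∀ φ : 𝓢(Rn n, ℂ), ∃ ψ : 𝓢(Rn n, ℂ), ∀ ξ, ψ ξ = (χ ξ : ℂ) * φ ξ

/-- The class `𝒦₀`: smooth members of `𝒦` which are multipliers on the Schwartz space and whose
inverses belong to `𝒦`; the derivatives up to order `2n⁺` have polynomial growth. -/
structure MemK₀ (χ : Rn n → ℝ) : Prop extends MemK χ where
  contDiff : ContDiff ℝ ∞ χ
  multiplier : IsSchwartzMultiplier χ
  inv_mem : MemK (fun ξ => (χ ξ)⁻¹)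
  derivBound : DerivBound χ

/-- The standing assumption on the weight: `χ ∈ 𝒦₁` if `p ≤ 2`, and `χ ∈ 𝒦₀` if `p > 2`. -/
def Admissible (p : ℝ≥0∞) (χ : Rn n → ℝ) : Prop :=
  (p ≤ 2 → MemK₁ χ) ∧ (2 < p → MemK₀ χ)

/-! ### The product of a weight and a tempered distribution -/

/-- The tempered distribution `T` is the measurable function `f`. -/
def IsFunction (T : 𝓢'(Rn n, ℂ)) (f : Rn n → ℂ) : Prop :=
  Measurable f ∧ ∀ φ : 𝓢(Rn n, ℂ),
    Integrable (fun x => f x * φ x) ∧ T φ = ∫ x, f x * φ x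

/-- `χ T = S`, for a tempered distribution `T` which is a measurable function `f`: the function
`χ f` is the tempered distribution `S`. -/
def IsFunctionProduct (χ : Rn n → ℝ) (T S : 𝓢'(Rn n, ℂ)) : Prop :=
  ∃ f : Rn n → ℂ, IsFunction T f ∧ IsFunction S (fun x => (χ x : ℂ) * f x)

/-- `χ T = S` for a multiplier `χ` on the Schwartz space: `S(φ) = T(χ φ)`. -/
def IsMultiplierProduct (χ : Rn n → ℝ) (T S : 𝓢'(Rn n, ℂ)) : Prop :=
  ∀ φ ψ : 𝓢(Rn n, ℂ), (∀ ξ, ψ ξ = (χ ξ : ℂ) * φ ξ) → S φ = T ψ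

/-- `χ T = S`, in the sense used for the exponent `p`. -/
def IsProduct (p : ℝ≥0∞) (χ : Rn n → ℝ) (T S : 𝓢'(Rn n, ℂ)) : Prop :=
  (p ≤ 2 → IsFunctionProduct χ T S) ∧ (2 < p → IsMultiplierProduct χ T S)

/-- `F⁻¹ χ F u` exists and is the element `v` of `L_p`. -/
def IsImage (p : ℝ≥0∞) [Fact (1 ≤ p)] (χ : Rn n → ℝ) (u : 𝓢'(Rn n, ℂ))
    (v : Lp ℂ p (volume : Measure (Rn n))) : Prop :=
  ∃ S : 𝓢'(Rn n, ℂ), IsProduct p χ (fourierD n u) S ∧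
    fourierInvD n S = Lp.toTemperedDistribution v

section Facts

theorem IsFunction.add {T T' : 𝓢'(Rn n, ℂ)} {f f' : Rn n → ℂ} (h : IsFunction T f)
    (h' : IsFunction T' f') : IsFunction (T + T') (fun x => f x + f' x) := by
  refine ⟨h.1.add h'.1, fun φ => ?_⟩
  have e : (fun x => (f x + f' x) * φ x) = fun x => f x * φ x + f' x * φ x := by
    ext x; ring
  rw [e]
  refine ⟨(h.2 φ).1.add (h'.2 φ).1, ?_⟩
  rw [integral_add (h.2 φ).1 (h'.2 φ).1, ← (h.2 φ).2, ← (h'.2 φ).2]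
  rfl

theorem IsFunction.smul {T : 𝓢'(Rn n, ℂ)} {f : Rn n → ℂ} (c : ℂ) (h : IsFunction T f) :
    IsFunction (c • T) (fun x => c * f x) := by
  refine ⟨h.1.const_mul c, fun φ => ?_⟩
  have e : (fun x => c * f x * φ x) = fun x => c * (f x * φ x) := by
    ext x; ring
  rw [e]
  refine ⟨(h.2 φ).1.const_mul c, ?_⟩
  rw [integral_const_mul, ← (h.2 φ).2]
  rfl

theorem IsFunction.zero : IsFunction (0 : 𝓢'(Rn n, ℂ)) (fun _ => 0) :=
  ⟨measurable_const, fun φ => by simp⟩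

theorem IsFunction.ae_eq_zero {f : Rn n → ℂ} (h : IsFunction (0 : 𝓢'(Rn n, ℂ)) f) :
    ∀ᵐ x, f x = 0 := by
  have key : ∀ g : Rn n → ℝ, ContDiff ℝ ∞ g → HasCompactSupport g →
      ∃ φ : 𝓢(Rn n, ℂ), ∀ x, φ x = (g x : ℂ) := by
    intro g hg hc
    have hg₁ : HasCompactSupport (Complex.ofRealCLM ∘ g) := hc.comp_left rfl
    have hg₂ : ContDiff ℝ ∞ (Complex.ofRealCLM ∘ g) := by fun_prop
    exact ⟨hg₁.toSchwartzMap hg₂, fun x => rfl⟩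
  apply ae_eq_zero_of_integral_contDiff_smul_eq_zero
  · intro x
    let b : ContDiffBump x := ⟨1, 2, one_pos, one_lt_two⟩
    obtain ⟨φ, hφ⟩ := key b b.contDiff b.hasCompactSupport
    refine ⟨Metric.closedBall x 1, Metric.closedBall_mem_nhds x one_pos, ?_⟩
    refine ((h.2 φ).1.integrableOn (s := Metric.closedBall x 1)).congr_fun ?_
      Metric.isClosed_closedBall.measurableSet
    intro y hy
    have : b y = 1 := b.one_of_mem_closedBall hy
    simp [hφ, this]
  · intro g hg hc
    obtain ⟨φ, hφ⟩ := key g hg hc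
    have := (h.2 φ).2
    simp only [hφ] at this
    rw [show (fun x => g x • f x) = fun x => f x * (g x : ℂ) from by
      ext x; rw [Complex.real_smul, mul_comm], ← this]
    rfl

theorem IsFunction.eq_zero {T : 𝓢'(Rn n, ℂ)} {f : Rn n → ℂ} (h : IsFunction T f)
    (hf : ∀ᵐ x, f x = 0) : T = 0 := by
  ext φ
  rw [(h.2 φ).2, integral_eq_zero_of_ae]
  · rfl
  · filter_upwards [hf] with x hx
    simp [hx]

variable {p : ℝ≥0∞} {χ : Rn n → ℝ}

theorem IsProduct.add {T T' S S' : 𝓢'(Rn n, ℂ)} (h : IsProduct p χ T S)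
    (h' : IsProduct p χ T' S') : IsProduct p χ (T + T') (S + S') := by
  refine ⟨fun hp => ?_, fun hp φ ψ hψ => ?_⟩
  · obtain ⟨f, h₁, h₂⟩ := h.1 hp
    obtain ⟨f', h₁', h₂'⟩ := h'.1 hp
    exact ⟨_, h₁.add h₁', by simpa only [mul_add] using h₂.add h₂'⟩
  · change S φ + S' φ = T ψ + T' ψ
    rw [h.2 hp φ ψ hψ, h'.2 hp φ ψ hψ]

theorem IsProduct.smul {T S : 𝓢'(Rn n, ℂ)} (c : ℂ) (h : IsProduct p χ T S) :
    IsProduct p χ (c • T) (c • S) := by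
  refine ⟨fun hp => ?_, fun hp φ ψ hψ => ?_⟩
  · obtain ⟨f, h₁, h₂⟩ := h.1 hp
    exact ⟨_, h₁.smul c, by simpa only [mul_left_comm] using h₂.smul c⟩
  · change c • S φ = c • T ψ
    rw [h.2 hp φ ψ hψ]

theorem IsProduct.zero : IsProduct p χ (0 : 𝓢'(Rn n, ℂ)) 0 :=
  ⟨fun _ => ⟨_, IsFunction.zero, by simpa using IsFunction.zero⟩, fun _ _ _ _ => rfl⟩

theorem IsProduct.eq_zero {S : 𝓢'(Rn n, ℂ)} (hχ : Admissible p χ) (h : IsProduct p χ 0 S) :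
    S = 0 := by
  rcases le_or_gt p 2 with hp | hp
  · obtain ⟨f, h₁, h₂⟩ := h.1 hp
    refine h₂.eq_zero ?_
    filter_upwards [h₁.ae_eq_zero] with x hx
    simp [hx]
  · ext φ
    obtain ⟨ψ, hψ⟩ := (hχ.2 hp).multiplier φ
    exact h.2 hp φ ψ hψ

variable [Fact (1 ≤ p)] {u u' : 𝓢'(Rn n, ℂ)} {v v' : Lp ℂ p (volume : Measure (Rn n))}

theorem IsImage.add (h : IsImage p χ u v) (h' : IsImage p χ u' v') :
    IsImage p χ (u + u') (v + v') := by
  obtain ⟨S, h₁, h₂⟩ := h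
  obtain ⟨S', h₁', h₂'⟩ := h'
  refine ⟨S + S', by simpa only [map_add] using h₁.add h₁', ?_⟩
  rw [map_add, h₂, h₂']
  exact (map_add (Lp.toTemperedDistributionCLM ℂ volume p) v v').symm

theorem IsImage.smul (c : ℂ) (h : IsImage p χ u v) : IsImage p χ (c • u) (c • v) := by
  obtain ⟨S, h₁, h₂⟩ := h
  refine ⟨c • S, by simpa only [map_smul] using h₁.smul c, ?_⟩
  rw [map_smul, h₂]
  exact (map_smul (Lp.toTemperedDistributionCLM ℂ volume p) c v).symm

theorem IsImage.zero : IsImage p χ (0 : 𝓢'(Rn n, ℂ)) 0 :=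
  ⟨0, by simpa only [map_zero] using IsProduct.zero, by
    rw [map_zero]; exact (map_zero (Lp.toTemperedDistributionCLM ℂ volume p)).symm⟩

/-- `F⁻¹ χ F u` is uniquely determined by `u`. -/
theorem IsImage.unique (hχ : Admissible p χ) (h : IsImage p χ u v) (h' : IsImage p χ u v') :
    v = v' := by
  have hd := h.add (h'.smul (-1))
  have e : u + (-1 : ℂ) • u = 0 := by
    ext φ
    change u φ + (-1 : ℂ) • u φ = 0
    simp
  rw [e] at hd
  obtain ⟨S, h₁, h₂⟩ := hd
  rw [map_zero] at h₁
  rw [h₁.eq_zero hχ, map_zero] at h₂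
  have hk : v + (-1 : ℂ) • v' ∈ (Lp.toTemperedDistributionCLM ℂ (volume : Measure (Rn n)) p).ker :=
    h₂.symm
  rw [Lp.ker_toTemperedDistributionCLM_eq_bot] at hk
  have : v + (-1 : ℂ) • v' = 0 := hk
  simpa [← sub_eq_add_neg, sub_eq_zero] using this

end Facts

/-! ### The space `H^χ_p(ℝⁿ)` -/

/-- The linear space `H^χ_p(ℝⁿ)` of all tempered distributions `u` with `F⁻¹ χ F u ∈ L_p(ℝⁿ)`.
If `p ≤ 2`, this includes the requirement that `F u` is a measurable function and that the function
`χ F u` is a tempered distribution. -/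
def HSubmodule (n : ℕ) (p : ℝ≥0∞) [Fact (1 ≤ p)] (χ : Rn n → ℝ) :
    Submodule ℂ 𝓢'(Rn n, ℂ) where
  carrier := {u | ∃ v, IsImage p χ u v}
  add_mem' := fun ⟨v, h⟩ ⟨v', h'⟩ => ⟨v + v', h.add h'⟩
  zero_mem' := ⟨0, IsImage.zero⟩
  smul_mem' := fun c _ ⟨v, h⟩ => ⟨c • v, h.smul c⟩

/-- The space `H^χ_p(ℝⁿ)`, as a type of its own: it carries the topology of its norm (below) and
not the one induced by `𝓢'`. -/
def HSpace (n : ℕ) (p : ℝ≥0∞) [Fact (1 ≤ p)] (χ : Rn n → ℝ) (_hχ : Admissible p χ) : Type :=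
  ↥(HSubmodule n p χ)

namespace HSpace

variable {p : ℝ≥0∞} [Fact (1 ≤ p)] {χ : Rn n → ℝ} {hχ : Admissible p χ}

instance : AddCommGroup (HSpace n p χ hχ) := inferInstanceAs (AddCommGroup ↥(HSubmodule n p χ))

instance : Module ℂ (HSpace n p χ hχ) := inferInstanceAs (Module ℂ ↥(HSubmodule n p χ))

/-- The inclusion `H^χ_p(ℝⁿ) → 𝓢'(ℝⁿ)`. -/
def toDistribution : HSpace n p χ hχ →ₗ[ℂ] 𝓢'(Rn n, ℂ) := (HSubmodule n p χ).subtype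

theorem exists_isImage (u : HSpace n p χ hχ) : ∃ v, IsImage p χ (toDistribution u) v := u.2

/-- The linear map `u ↦ F⁻¹ χ F u` from `H^χ_p(ℝⁿ)` to `L_p(ℝⁿ)`. -/
def image : HSpace n p χ hχ →ₗ[ℂ] Lp ℂ p (volume : Measure (Rn n)) where
  toFun u := (exists_isImage u).choose
  map_add' u u' := IsImage.unique hχ (exists_isImage (u + u')).choose_spec <| by
    rw [map_add]
    exact (exists_isImage u).choose_spec.add (exists_isImage u').choose_spec
  map_smul' c u := IsImage.unique hχ (exists_isImage (c • u)).choose_spec <| by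
    rw [map_smul]
    exact (exists_isImage u).choose_spec.smul c

theorem isImage_image (u : HSpace n p χ hχ) : IsImage p χ (toDistribution u) (image u) :=
  (exists_isImage u).choose_spec

/-- `H^χ_p(ℝⁿ)` carries the norm `‖u‖ = ‖F⁻¹ χ F u‖_{L_p}` and its topology. (That `‖u‖ = 0` only
for `u = 0` is not needed to define these.) -/
instance : SeminormedAddCommGroup (HSpace n p χ hχ) :=
  SeminormedAddCommGroup.induced _ _ (image (hχ := hχ))

theorem norm_def (u : HSpace n p χ hχ) : ‖u‖ = ‖image u‖ := rfl

instance : NormedSpace ℂ (HSpace n p χ hχ) where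
  norm_smul_le c u := by rw [norm_def, norm_def, map_smul, norm_smul]

end HSpace

end GenSobolev

end

noncomputable section

namespace GenSobolev

open Filter Topology

section DecayWeight

variable {E : Type*} [NormedAddCommGroup E]

/-- The weight `(1 + ‖x‖) ^ (-N)`. -/
def decayWeight (N : ℕ) (x : E) : ℝ := ((1 + ‖x‖) ^ N)⁻¹

theorem decayWeight_pos (N : ℕ) (x : E) : 0 < decayWeight N x := by
  unfold decayWeight
  positivity

theorem continuous_decayWeight (N : ℕ) : Continuous (decayWeight N : E → ℝ) := by
  unfold decayWeight
  exact Continuous.inv₀ (by fun_prop) fun x => by positivity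

theorem decayWeight_rpow (N : ℕ) (q : ℝ) (x : E) :
    decayWeight N x ^ q = (1 + ‖x‖) ^ (-((N : ℝ) * q)) := by
  rw [decayWeight, ← Real.rpow_natCast, ← Real.rpow_neg (by positivity),
    ← Real.rpow_mul (by positivity), neg_mul]

end DecayWeight

section Growth

variable {E F : Type*} [NormedAddCommGroup E] [NormedSpace ℝ E]
  [NormedAddCommGroup F] [NormedSpace ℝ F]

/-- `f` is of class `C^N` and its derivatives up to order `N` grow at most polynomially. -/
structure HasPolyGrowth (N : ℕ) (f : E → F) : Prop where
  contDiff : ContDiff ℝ N f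
  exists_bound : ∃ (C : ℝ) (L : ℕ), 0 ≤ C ∧
    ∀ k ≤ N, ∀ x, ‖iteratedFDeriv ℝ k f x‖ ≤ C * (1 + ‖x‖) ^ L

/-- `f` is of class `C^N` and its derivatives up to order `N` are bounded by
`M (1 + ‖x‖) ^ (-r)`. -/
structure HasDecay (N r : ℕ) (f : E → F) (M : ℝ) : Prop where
  contDiff : ContDiff ℝ N f
  bound : ∀ k ≤ N, ∀ x, (1 + ‖x‖) ^ r * ‖iteratedFDeriv ℝ k f x‖ ≤ M

theorem HasPolyGrowth.mono {N K : ℕ} {f : E → F} (hf : HasPolyGrowth N f) (h : K ≤ N) :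
    HasPolyGrowth K f := by
  obtain ⟨C, L, hC, hb⟩ := hf.exists_bound
  exact ⟨hf.contDiff.of_le (by exact_mod_cast h), C, L, hC, fun k hk => hb k (hk.trans h)⟩

theorem hasPolyGrowth_const (N : ℕ) (c : F) : HasPolyGrowth N (fun _ : E => c) := by
  refine ⟨contDiff_const, ‖c‖, 0, norm_nonneg _, fun k _ x => ?_⟩
  rcases Nat.eq_zero_or_pos k with rfl | hk
  · simp
  · rw [iteratedFDeriv_const_of_ne hk.ne']
    simp

theorem HasPolyGrowth.of_fderiv {N : ℕ} {f : E → F} (hd : Differentiable ℝ f)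
    (h₀ : ∃ (C : ℝ) (L : ℕ), 0 ≤ C ∧ ∀ x, ‖f x‖ ≤ C * (1 + ‖x‖) ^ L)
    (h₁ : HasPolyGrowth N (fderiv ℝ f)) : HasPolyGrowth (N + 1) f := by
  obtain ⟨C, L, hC, hb⟩ := h₀
  obtain ⟨C', L', hC', hb'⟩ := h₁.exists_bound
  refine ⟨?_, C + C', L + L', by positivity, fun k hk x => ?_⟩
  · have := (contDiff_succ_iff_fderiv (n := (N : WithTop ℕ∞))).2
      ⟨hd, fun h => absurd h (WithTop.coe_ne_top), h₁.contDiff⟩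
    exact_mod_cast this
  · have h1 : (1 : ℝ) ≤ 1 + ‖x‖ := by linarith [norm_nonneg x]
    have hL : (1 + ‖x‖) ^ L ≤ (1 + ‖x‖) ^ (L + L') := pow_le_pow_right₀ h1 (by omega)
    have hL' : (1 + ‖x‖) ^ L' ≤ (1 + ‖x‖) ^ (L + L') := pow_le_pow_right₀ h1 (by omega)
    rw [add_mul]
    rcases k with _ | k
    · rw [norm_iteratedFDeriv_zero]
      have := (hb x).trans (mul_le_mul_of_nonneg_left hL hC)
      have : 0 ≤ C' * (1 + ‖x‖) ^ (L + L') := by positivity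
      linarith
    · rw [← norm_iteratedFDeriv_fderiv]
      have := (hb' k (by omega) x).trans (mul_le_mul_of_nonneg_left hL' hC')
      have : 0 ≤ C * (1 + ‖x‖) ^ (L + L') := by positivity
      linarith

theorem HasPolyGrowth.fderiv_of_succ {N : ℕ} {f : E → F} (hf : HasPolyGrowth (N + 1) f) :
    HasPolyGrowth N (fderiv ℝ f) := by
  obtain ⟨C, L, hC, hb⟩ := hf.exists_bound
  refine ⟨hf.contDiff.fderiv_right (by norm_cast), C, L, hC, fun k hk x => ?_⟩
  rw [norm_iteratedFDeriv_fderiv]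
  exact hb _ (by omega) x

theorem norm_iteratedFDeriv_smul_le_of_bound {N : ℕ} {f : E → ℝ} {g : E → F}
    (hf : ContDiff ℝ N f) (hg : ContDiff ℝ N g) {x : E} {A B : ℝ}
    (hfA : ∀ k ≤ N, ‖iteratedFDeriv ℝ k f x‖ ≤ A) (hgB : ∀ k ≤ N, ‖iteratedFDeriv ℝ k g x‖ ≤ B)
    {k : ℕ} (hk : k ≤ N) :
    ‖iteratedFDeriv ℝ k (fun y => f y • g y) x‖ ≤ 2 ^ N * (A * B) := by
  have hA : 0 ≤ A := (norm_nonneg _).trans (hfA 0 (by omega))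
  have hB : 0 ≤ B := (norm_nonneg _).trans (hgB 0 (by omega))
  calc ‖iteratedFDeriv ℝ k (fun y => f y • g y) x‖
      ≤ ∑ i ∈ Finset.range (k + 1), (k.choose i : ℝ) * ‖iteratedFDeriv ℝ i f x‖ *
          ‖iteratedFDeriv ℝ (k - i) g x‖ :=
        norm_iteratedFDeriv_smul_le hf hg x (by exact_mod_cast hk)
    _ ≤ ∑ i ∈ Finset.range (k + 1), (k.choose i : ℝ) * (A * B) := by
        refine Finset.sum_le_sum fun i hi => ?_
        rw [mul_assoc]
        have hi' : i ≤ k := Nat.lt_succ_iff.1 (Finset.mem_range.1 hi)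
        exact mul_le_mul_of_nonneg_left (mul_le_mul (hfA i (by omega)) (hgB _ (by omega))
          (norm_nonneg _) hA) (by positivity)
    _ = 2 ^ k * (A * B) := by
        rw [← Finset.sum_mul]
        congr 1
        exact_mod_cast Nat.sum_range_choose k
    _ ≤ 2 ^ N * (A * B) := by
        gcongr
        norm_num

theorem HasPolyGrowth.smul {N : ℕ} {f : E → ℝ} {g : E → F} (hf : HasPolyGrowth N f)
    (hg : HasPolyGrowth N g) : HasPolyGrowth N (fun x => f x • g x) := by
  obtain ⟨C, L, hC, hb⟩ := hf.exists_bound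
  obtain ⟨C', L', hC', hb'⟩ := hg.exists_bound
  refine ⟨hf.contDiff.smul hg.contDiff, 2 ^ N * (C * C'), L + L', by positivity, fun k hk x => ?_⟩
  refine (norm_iteratedFDeriv_smul_le_of_bound hf.contDiff hg.contDiff (fun k hk => hb k hk x)
    (fun k hk => hb' k hk x) hk).trans_eq ?_
  rw [pow_add]
  ring

theorem HasPolyGrowth.inv {N : ℕ} {χ : E → ℝ} (hχ : HasPolyGrowth N χ) (hpos : ∀ x, 0 < χ x)
    (hinv : ∃ (C : ℝ) (L : ℕ), 0 ≤ C ∧ ∀ x, (χ x)⁻¹ ≤ C * (1 + ‖x‖) ^ L) :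
    HasPolyGrowth N (fun x => (χ x)⁻¹) := by
  have h₀ : ∃ (C : ℝ) (L : ℕ), 0 ≤ C ∧ ∀ x, ‖(χ x)⁻¹‖ ≤ C * (1 + ‖x‖) ^ L := by
    obtain ⟨C, L, hC, hb⟩ := hinv
    refine ⟨C, L, hC, fun x => ?_⟩
    rw [Real.norm_of_nonneg (inv_nonneg.2 (hpos x).le)]
    exact hb x
  suffices ∀ K ≤ N, HasPolyGrowth K (fun x => (χ x)⁻¹) from this N le_rfl
  intro K
  induction K with
  | zero =>
    intro _
    obtain ⟨C, L, hC, hb⟩ := h₀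
    refine ⟨hχ.contDiff.inv (fun x => (hpos x).ne') |>.of_le (by exact_mod_cast Nat.zero_le N), C, L,
      hC, fun k hk x => ?_⟩
    obtain rfl : k = 0 := by omega
    rw [norm_iteratedFDeriv_zero]
    exact hb x
  | succ K ih =>
    intro hK
    have hχ' := hχ.mono hK
    have hd : Differentiable ℝ χ := hχ'.contDiff.differentiable (by simp)
    have hd' : ∀ x, HasFDerivAt (fun x => (χ x)⁻¹)
        ((-1 : ℝ) • ((χ x)⁻¹ • ((χ x)⁻¹ • fderiv ℝ χ x))) x := by
      intro x
      have h := (hasDerivAt_inv (hpos x).ne').comp_hasFDerivAt x (hd x).hasFDerivAt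
      have e : (-1 : ℝ) • ((χ x)⁻¹ • ((χ x)⁻¹ • fderiv ℝ χ x)) =
          (-(χ x ^ 2)⁻¹) • fderiv ℝ χ x := by
        rw [smul_smul, smul_smul]
        congr 1
        field_simp
      rw [e]
      exact h
    refine HasPolyGrowth.of_fderiv (fun x => (hd' x).differentiableAt) h₀ ?_
    have : fderiv ℝ (fun x => (χ x)⁻¹) =
        fun x => (-1 : ℝ) • ((χ x)⁻¹ • ((χ x)⁻¹ • fderiv ℝ χ x)) := funext fun x => (hd' x).fderiv
    rw [this]
    have hI := ih (by omega)
    exact (hasPolyGrowth_const K (-1 : ℝ)).smul (hI.smul (hI.smul hχ'.fderiv_of_succ))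

theorem HasDecay.nonneg {N r : ℕ} {f : E → F} {M : ℝ} (hf : HasDecay N r f M) : 0 ≤ M :=
  le_trans (by positivity) (hf.bound 0 (Nat.zero_le _) 0)

theorem HasPolyGrowth.exists_hasDecay_smul {N : ℕ} {m : E → ℝ} (hm : HasPolyGrowth N m) (r : ℕ) :
    ∃ (A : ℝ) (s : ℕ), 0 ≤ A ∧ ∀ (f : E → F) (M : ℝ), HasDecay N s f M →
      HasDecay N r (fun x => m x • f x) (A * M) := by
  obtain ⟨C, L, hC, hb⟩ := hm.exists_bound
  refine ⟨2 ^ N * C, r + L, by positivity, fun f M hf => ⟨hm.contDiff.smul hf.contDiff,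
    fun k hk x => ?_⟩⟩
  have hx : 0 < 1 + ‖x‖ := by positivity
  have h := norm_iteratedFDeriv_smul_le_of_bound hm.contDiff hf.contDiff (x := x)
    (fun k hk => hb k hk x)
    (B := M / (1 + ‖x‖) ^ (r + L)) (fun k hk => by
      rw [le_div_iff₀ (by positivity), mul_comm]
      exact hf.bound k hk x) hk
  refine (mul_le_mul_of_nonneg_left h (by positivity)).trans_eq ?_
  rw [pow_add]
  field_simp

theorem hasDecay_schwartz (𝕜 : Type*) [NormedField 𝕜] [NormedSpace 𝕜 F] [SMulCommClass ℝ 𝕜 F]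
    (N r : ℕ) (f : 𝓢(E, F)) :
    HasDecay N r f (2 ^ r * (Finset.Iic (r, N)).sup (schwartzSeminormFamily 𝕜 E F) f) :=
  ⟨f.smooth N, fun _ hk x => SchwartzMap.one_add_le_sup_seminorm_apply (m := (r, N)) le_rfl hk f x⟩

theorem hasDecay_of_support_subset {N : ℕ} (r : ℕ) {f : E → F} {R ε : ℝ} (hR : 0 ≤ R)
    (hf : ContDiff ℝ N f)
    (hs : tsupport f ⊆ Metric.closedBall 0 R) (hε : 0 ≤ ε)
    (hb : ∀ k ≤ N, ∀ x, ‖iteratedFDeriv ℝ k f x‖ ≤ ε) : HasDecay N r f ((1 + R) ^ r * ε) := by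
  refine ⟨hf, fun k hk x => ?_⟩
  by_cases hx : x ∈ tsupport f
  · have : ‖x‖ ≤ R := by simpa using hs hx
    exact mul_le_mul (by gcongr) (hb k hk x) (norm_nonneg _) (by positivity)
  · have : iteratedFDeriv ℝ k f x = 0 := by
      by_contra h
      exact hx (support_iteratedFDeriv_subset k h)
    rw [this]
    simp only [norm_zero, mul_zero]
    positivity

theorem HasDecay.norm_iteratedFDeriv_le {N r : ℕ} {f : E → F} {M : ℝ}
    (hf : HasDecay N r f M) {k : ℕ} (hk : k ≤ N) (x : E) :
    ‖iteratedFDeriv ℝ k f x‖ ≤ M * decayWeight r x := by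
  rw [decayWeight, ← div_eq_mul_inv, le_div_iff₀ (by positivity), mul_comm]
  exact hf.bound k hk x

theorem exists_decayWeight_smul_le (N : ℕ) {a : ℝ} (ha : a ≠ 0) :
    ∃ A : ℝ, 0 ≤ A ∧ ∀ x : E, decayWeight N (a • x) ≤ A * decayWeight N x := by
  refine ⟨(1 + |a|⁻¹) ^ N, by positivity, fun x => ?_⟩
  rw [decayWeight, decayWeight, ← div_eq_mul_inv, le_div_iff₀ (by positivity), ← div_eq_inv_mul,
    div_le_iff₀ (by positivity), ← mul_pow, norm_smul, Real.norm_eq_abs]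
  gcongr
  have : |a|⁻¹ * (|a| * ‖x‖) = ‖x‖ := by
    rw [← mul_assoc, inv_mul_cancel₀ (abs_ne_zero.2 ha), one_mul]
  have h1 : 0 ≤ |a|⁻¹ := by positivity
  have h2 : 0 ≤ |a| * ‖x‖ := by positivity
  nlinarith

theorem HasPolyGrowth.exists_hasDecay_smul_schwartz {N : ℕ} {m : E → ℝ} (hm : HasPolyGrowth N m)
    (r : ℕ) :
    ∃ (s : Finset (ℕ × ℕ)) (C : ℝ), 0 ≤ C ∧ ∀ ψ : 𝓢(E, ℂ),
      HasDecay N r (fun x => m x • ψ x) (C * s.sup (schwartzSeminormFamily ℂ E ℂ) ψ) := by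
  obtain ⟨A, s, hA, h⟩ := hm.exists_hasDecay_smul (F := ℂ) r
  refine ⟨Finset.Iic (s, N), A * 2 ^ s, by positivity, fun ψ => ?_⟩
  rw [mul_assoc]
  exact h _ _ (hasDecay_schwartz ℂ N s ψ)

end Growth

section Approximation

variable {E : Type} [NormedAddCommGroup E] [NormedSpace ℝ E] [FiniteDimensional ℝ E]
  [MeasurableSpace E] [BorelSpace E] (μ : Measure E) [μ.IsAddHaarMeasure]

/-- The mollification of `g` with a smooth bump function. -/
def mollify {F : Type} [NormedAddCommGroup F] [NormedSpace ℝ F] (b : ContDiffBump (0 : E))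
    (g : E → F) : E → F :=
  convolution (b.normed μ) g (ContinuousLinearMap.lsmul ℝ ℝ) μ

variable {F : Type} [NormedAddCommGroup F] [NormedSpace ℝ F]

theorem hasFDerivAt_mollify (b : ContDiffBump (0 : E)) {g : E → F} (hg : HasCompactSupport g)
    (hg₁ : ContDiff ℝ 1 g) (x : E) :
    HasFDerivAt (mollify μ b g) (mollify μ b (fderiv ℝ g) x) x := by
  have h := HasCompactSupport.hasFDerivAt_convolution_right (μ := μ) (f := b.normed μ)
    (ContinuousLinearMap.lsmul ℝ ℝ : ℝ →L[ℝ] F →L[ℝ] F) hg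
    (b.continuous_normed.locallyIntegrable) hg₁ x
  have e : mollify μ b (fderiv ℝ g) x = convolution (b.normed μ) (fderiv ℝ g)
      (ContinuousLinearMap.precompR E (ContinuousLinearMap.lsmul ℝ ℝ)) μ x :=
    integral_congr_ae (ae_of_all _ fun t => by ext v; simp)
  rw [e]
  exact h

theorem eventually_mollify_close [CompleteSpace F] {k : ℕ} {g : E → F} (hg : HasCompactSupport g)
    (hgk : ContDiff ℝ k g) {ε : ℝ} (hε : 0 < ε) :
    ∃ δ > 0, ∀ b : ContDiffBump (0 : E), b.rOut < δ → ∀ x,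
      ‖iteratedFDeriv ℝ k (fun y => mollify μ b g y - g y) x‖ ≤ ε := by
  induction k generalizing F with
  | zero =>
    have hu := hg.uniformContinuous_of_continuous hgk.continuous
    obtain ⟨δ, hδ, h⟩ := Metric.uniformContinuous_iff.1 hu ε hε
    refine ⟨δ, hδ, fun b hb x => ?_⟩
    rw [norm_iteratedFDeriv_zero, ← dist_eq_norm]
    exact ContDiffBump.dist_normed_convolution_le hgk.continuous.aestronglyMeasurable
      fun y hy => (h (lt_trans hy hb)).le
  | succ k ih =>
    have hg₁ : ContDiff ℝ 1 g := hgk.of_le (by norm_cast; omega)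
    obtain ⟨δ, hδ, h⟩ := ih (hg.fderiv ℝ) (hgk.fderiv_right (by norm_cast))
    refine ⟨δ, hδ, fun b hb x => ?_⟩
    rw [← norm_iteratedFDeriv_fderiv]
    convert h b hb x using 4
    rename_i y
    exact ((hasFDerivAt_mollify μ b hg hg₁ y).sub
      (hg₁.differentiable (by simp) y).hasFDerivAt).fderiv

theorem eventually_mollify_close_of_le [CompleteSpace F] {N : ℕ} {g : E → F}
    (hg : HasCompactSupport g) (hgN : ContDiff ℝ N g) {ε : ℝ} (hε : 0 < ε) :
    ∃ δ > 0, ∀ b : ContDiffBump (0 : E), b.rOut < δ → ∀ k ≤ N, ∀ x,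
      ‖iteratedFDeriv ℝ k (fun y => mollify μ b g y - g y) x‖ ≤ ε := by
  induction N with
  | zero =>
    obtain ⟨δ, hδ, h⟩ := eventually_mollify_close μ hg hgN hε
    refine ⟨δ, hδ, fun b hb k hk => ?_⟩
    obtain rfl : k = 0 := by omega
    exact h b hb
  | succ N ih =>
    obtain ⟨δ, hδ, h⟩ := eventually_mollify_close μ hg hgN hε
    obtain ⟨δ', hδ', h'⟩ := ih (hgN.of_le (by norm_cast; omega))
    refine ⟨min δ δ', lt_min hδ hδ', fun b hb k hk => ?_⟩
    rcases Nat.lt_or_ge N k with hkN | hkN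
    · obtain rfl : k = N + 1 := by omega
      exact h b (hb.trans_le (min_le_left _ _))
    · exact h' b (hb.trans_le (min_le_right _ _)) k hkN

/-- A compactly supported function of class `C^N` is the limit, in the sense of uniform convergence
of the derivatives up to order `N`, of test functions supported in a fixed ball. -/
theorem exists_schwartz_approx [CompleteSpace F] {N : ℕ} {g : E → F} (hg : HasCompactSupport g)
    (hgN : ContDiff ℝ N g) :
    ∃ (R : ℝ) (h : ℕ → 𝓢(E, F)), 0 ≤ R ∧ tsupport g ⊆ Metric.closedBall 0 R ∧
      (∀ j, tsupport (h j) ⊆ Metric.closedBall 0 R) ∧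
      ∀ j, ∀ k ≤ N, ∀ x, ‖iteratedFDeriv ℝ k (fun y => h j y - g y) x‖ ≤ 1 / ((j : ℝ) + 1) := by
  obtain ⟨R, hR⟩ := hg.isCompact.isBounded.subset_closedBall (0 : E)
  let μ : Measure E := Measure.addHaar
  have key : ∀ j : ℕ, ∃ h : 𝓢(E, F), tsupport h ⊆ Metric.closedBall 0 (max R 0 + 1) ∧
      ∀ k ≤ N, ∀ x, ‖iteratedFDeriv ℝ k (fun y => h y - g y) x‖ ≤ 1 / ((j : ℝ) + 1) := by
    intro j
    obtain ⟨δ, hδ, hb⟩ := eventually_mollify_close_of_le μ hg hgN (ε := 1 / ((j : ℝ) + 1))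
      (by positivity)
    have hδ' : 0 < min δ 1 := lt_min hδ one_pos
    let b : ContDiffBump (0 : E) := ⟨min δ 1 / 4, min δ 1 / 2, by positivity, by linarith⟩
    have hbc : HasCompactSupport (mollify μ b g) :=
      HasCompactSupport.convolution _ b.hasCompactSupport_normed hg
    have hbs : ContDiff ℝ ∞ (mollify μ b g) :=
      HasCompactSupport.contDiff_convolution_left _ b.hasCompactSupport_normed b.contDiff_normed
        (hgN.continuous.locallyIntegrable)
    refine ⟨hbc.toSchwartzMap hbs, ?_, ?_⟩
    · refine closure_minimal ?_ Metric.isClosed_closedBall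
      refine (support_convolution_subset (ContinuousLinearMap.lsmul ℝ ℝ)).trans ?_
      rintro _ ⟨y, hy, z, hz, rfl⟩
      rw [b.support_normed_eq] at hy
      have h1 : ‖y‖ < min δ 1 / 2 := by simpa using hy
      have h2 : ‖z‖ ≤ R := by simpa using hR (subset_tsupport _ hz)
      have h3 : min δ 1 ≤ 1 := min_le_right _ _
      simp only [mem_closedBall_zero_iff]
      have := norm_add_le y z
      have := le_max_left R 0
      linarith
    · exact hb b (show min δ 1 / 2 < δ by linarith [min_le_left δ 1])
  choose h h₁ h₂ using key
  refine ⟨max R 0 + 1, h, by positivity, hR.trans (Metric.closedBall_subset_closedBall ?_), h₁, h₂⟩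
  linarith [le_max_left R 0]

/-- Compactly supported Schwartz functions are dense in the Schwartz space. -/
theorem exists_tendsto_hasCompactSupport {E F : Type*} [NormedAddCommGroup E] [NormedSpace ℝ E]
    [FiniteDimensional ℝ E] [NormedAddCommGroup F] [NormedSpace ℝ F] (ψ : 𝓢(E, F)) :
    ∃ h : ℕ → 𝓢(E, F), (∀ j, HasCompactSupport (h j)) ∧ Tendsto h atTop (𝓝 ψ) := by
  let b : ContDiffBump (0 : E) := ⟨1, 2, one_pos, one_lt_two⟩
  let a : ℕ → ℝ := fun j => ((j : ℝ) + 1)⁻¹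
  have ha : ∀ j, 0 < a j := fun j => by positivity
  have ha1 : ∀ j, a j ≤ 1 := fun j => inv_le_one_of_one_le₀ (by linarith [j.cast_nonneg (α := ℝ)])
  have hθs : ∀ j, ContDiff ℝ ∞ (fun x : E => b (a j • x)) := fun j =>
    b.contDiff.comp (contDiff_const_smul (a j))
  have hθc : ∀ j, HasCompactSupport (fun x : E => b (a j • x)) := fun j =>
    b.hasCompactSupport.comp_smul (ha j).ne'
  let h : ℕ → 𝓢(E, F) := fun j =>
    ((hθc j).smul_right (f' := (ψ : E → F))).toSchwartzMap ((hθs j).smul (ψ.smooth _))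
  refine ⟨h, fun j => (hθc j).smul_right, ?_⟩
  rw [(schwartz_withSeminorms ℝ E F).tendsto_nhds]
  rintro ⟨k, n⟩ ε hε
  obtain ⟨B, hB0, hB⟩ : ∃ B : ℝ, 0 ≤ B ∧
      ∀ i ≤ n, ∀ x : E, ‖iteratedFDeriv ℝ i (fun y => b y - 1) x‖ ≤ B := by
    have hd := hasDecay_schwartz ℝ n 0 (b.hasCompactSupport.toSchwartzMap b.contDiff)
    refine ⟨_, add_nonneg hd.nonneg zero_le_one, fun i hi x => ?_⟩
    have e : iteratedFDeriv ℝ i (fun y => b y - 1) x =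
        iteratedFDeriv ℝ i b x - iteratedFDeriv ℝ i (fun _ : E => (1 : ℝ)) x :=
      iteratedFDeriv_sub_apply (b.contDiff.contDiffAt) contDiffAt_const
    rw [e]
    refine (norm_sub_le _ _).trans (add_le_add ?_ ?_)
    · have := hd.bound i hi x
      rwa [pow_zero, one_mul] at this
    · rcases Nat.eq_zero_or_pos i with rfl | hi'
      · simp
      · rw [iteratedFDeriv_const_of_ne hi'.ne']
        simp
  have hψ := hasDecay_schwartz ℝ n (k + 1) ψ
  set M := 2 ^ (k + 1) * (Finset.Iic (k + 1, n)).sup (schwartzSeminormFamily ℝ E F) ψ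
  have hM := hψ.nonneg
  have hlim : Tendsto (fun j : ℕ => 2 ^ n * (B * M) * (1 / ((j : ℝ) + 1))) atTop (𝓝 0) := by
    simpa using tendsto_one_div_add_atTop_nhds_zero_nat.const_mul (2 ^ n * (B * M))
  filter_upwards [hlim.eventually_lt_const hε] with j hj
  refine lt_of_le_of_lt (SchwartzMap.seminorm_le_bound ℝ k n _ (by positivity) fun x => ?_) hj
  have hco : (⇑(h j - ψ) : E → F) = fun x => (b (a j • x) - 1) • ψ x := by
    ext x
    rw [sub_smul, one_smul]
    rfl
  rw [hco]
  have hx : 0 < 1 + ‖x‖ := by positivity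
  rcases lt_or_ge ‖x‖ ((j : ℝ) + 1) with hxj | hxj
  · have : (fun x => (b (a j • x) - 1) • ψ x) =ᶠ[𝓝 x] fun _ => 0 := by
      have ho : IsOpen {y : E | ‖y‖ < (j : ℝ) + 1} := isOpen_lt continuous_norm continuous_const
      filter_upwards [ho.mem_nhds hxj] with y hy
      have : b (a j • y) = 1 := by
        apply b.one_of_mem_closedBall
        rw [mem_closedBall_zero_iff, norm_smul, Real.norm_of_nonneg (ha j).le]
        exact (inv_mul_le_one₀ (by positivity)).2 (le_of_lt hy)
      rw [this, sub_self, zero_smul]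
    rw [(this.iteratedFDeriv ℝ n).eq_of_nhds, iteratedFDeriv_fun_zero, Pi.zero_apply]
    simp only [norm_zero, mul_zero]
    positivity
  · have hc : ContDiff ℝ ∞ (fun y => b y - 1) := b.contDiff.sub contDiff_const
    have hA : ∀ i ≤ n, ‖iteratedFDeriv ℝ i (fun y => b (a j • y) - 1) x‖ ≤ B := fun i hi => by
      rw [iteratedFDeriv_comp_const_smul (f := fun y => b y - 1) (a j)
        (hc.of_le (by exact_mod_cast le_top)), norm_smul, norm_pow,
        Real.norm_of_nonneg (ha j).le]
      exact (mul_le_of_le_one_left (norm_nonneg _) (pow_le_one₀ (ha j).le (ha1 j))).trans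
        (hB i hi _)
    have hl := norm_iteratedFDeriv_smul_le_of_bound (N := n) (x := x)
      ((hθs j).sub contDiff_const |>.of_le (by exact_mod_cast le_top))
      (ψ.smooth n) hA (B := M / (1 + ‖x‖) ^ (k + 1)) (fun i hi => by
        rw [le_div_iff₀ (by positivity), mul_comm]
        exact hψ.bound i hi x) le_rfl
    calc ‖x‖ ^ k * ‖iteratedFDeriv ℝ n (fun x => (b (a j • x) - 1) • ψ x) x‖
        ≤ (1 + ‖x‖) ^ k * (2 ^ n * (B * (M / (1 + ‖x‖) ^ (k + 1)))) := by
          refine mul_le_mul ?_ hl (norm_nonneg _) (by positivity)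
          gcongr
          linarith
      _ = 2 ^ n * (B * M) * (1 / (1 + ‖x‖)) := by
          rw [pow_succ]
          field_simp
      _ ≤ 2 ^ n * (B * M) * (1 / ((j : ℝ) + 1)) := by
          exact mul_le_mul_of_nonneg_left
            (one_div_le_one_div_of_le (by positivity) (by linarith)) (by positivity)

end Approximation

section ScaledFourier

variable {E : Type} [NormedAddCommGroup E] [InnerProductSpace ℝ E] [FiniteDimensional ℝ E]
  [MeasurableSpace E] [BorelSpace E]

/-- The rescaled Fourier transform `x ↦ c (𝓕 g)(a x)`. -/
def scaledFourier (c : ℂ) (a : ℝ) (g : E → ℂ) (x : E) : ℂ := c * 𝓕 g (a • x)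

theorem scaledFourier_eq (c : ℂ) (a : ℝ) (g : E → ℂ) (x : E) :
    scaledFourier c a g x =
      c * VectorFourier.fourierIntegral Real.fourierChar volume (a • innerₗ E) g x := by
  simp [scaledFourier, Real.fourier_eq, VectorFourier.fourierIntegral, inner_smul_right]

theorem integral_scaledFourier_mul (c : ℂ) (a : ℝ) {f g : E → ℂ} (hf : Integrable f)
    (hg : Integrable g) :
    ∫ x, scaledFourier c a f x * g x = ∫ x, f x * scaledFourier c a g x := by
  have hflip : (a • innerₗ E).flip = a • innerₗ E := by
    ext x y
    simp [real_inner_comm]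
  have h := VectorFourier.integral_fourierIntegral_smul_eq_flip (L := a • innerₗ E)
    (μ := (volume : Measure E)) (ν := (volume : Measure E)) Real.continuous_fourierChar
    (by simpa using (continuous_inner (𝕜 := ℝ) (E := E)).const_mul a) hf hg
  rw [hflip] at h
  simp only [smul_eq_mul] at h
  simp only [scaledFourier_eq, mul_assoc, mul_left_comm _ c]
  rw [integral_const_mul, integral_const_mul, h]

theorem continuous_scaledFourier (c : ℂ) (a : ℝ) {g : E → ℂ} (hg : Integrable g) :
    Continuous (scaledFourier c a g) := by
  have h := VectorFourier.fourierIntegral_continuous (L := a • innerₗ E)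
    (μ := (volume : Measure E)) Real.continuous_fourierChar
    (by simpa using (continuous_inner (𝕜 := ℝ) (E := E)).const_mul a) hg
  rw [funext (scaledFourier_eq c a g)]
  exact h.const_mul c

theorem scaledFourier_add (c : ℂ) (a : ℝ) {f g : E → ℂ} (hf : Integrable f) (hg : Integrable g)
    (x : E) : scaledFourier c a (fun y => f y + g y) x =
      scaledFourier c a f x + scaledFourier c a g x := by
  have h := VectorFourier.fourierIntegral_add (L := a • innerₗ E)
    (μ := (volume : Measure E)) Real.continuous_fourierChar
    (by simpa using (continuous_inner (𝕜 := ℝ) (E := E)).const_mul a) hf hg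
  simp only [scaledFourier_eq, ← mul_add]
  exact congrArg (c * ·) (congrFun h.symm x).symm

theorem scaledFourier_const_mul (c : ℂ) (a : ℝ) (z : ℂ) (g : E → ℂ) (x : E) :
    scaledFourier c a (fun y => z * g y) x = z * scaledFourier c a g x := by
  simp only [scaledFourier, Real.fourier_eq]
  rw [mul_left_comm, ← integral_const_mul z]
  refine congrArg (c * ·) (integral_congr_ae (ae_of_all _ fun v => ?_))
  simp only [Circle.smul_def, smul_eq_mul]
  ring

variable {N : ℕ}

theorem memLp_decayWeight (hN : Module.finrank ℝ E < N) {q : ℝ≥0∞} (hq : 1 ≤ q) (hq' : q ≠ ⊤) :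
    MemLp (decayWeight N : E → ℝ) q := by
  rw [← integrable_norm_rpow_iff (continuous_decayWeight N).aestronglyMeasurable
    (zero_lt_one.trans_le hq).ne' hq']
  simp only [Real.norm_of_nonneg (decayWeight_pos _ _).le, decayWeight_rpow]
  apply integrable_one_add_norm
  have h1 : (1 : ℝ) ≤ q.toReal := by
    simpa using ENNReal.toReal_mono hq' hq
  have h2 : (Module.finrank ℝ E : ℝ) < N := by exact_mod_cast hN
  nlinarith

theorem integrable_decayWeight (hN : Module.finrank ℝ E < N) :
    Integrable (decayWeight N : E → ℝ) :=
  memLp_one_iff_integrable.1 (memLp_decayWeight hN le_rfl ENNReal.one_ne_top)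

theorem HasDecay.integrable_iteratedFDeriv {F : Type*} [NormedAddCommGroup F] [NormedSpace ℝ F]
    {r : ℕ} (hr : Module.finrank ℝ E < r) {f : E → F} {M : ℝ} (hf : HasDecay N r f M) {k : ℕ}
    (hk : k ≤ N) : Integrable (iteratedFDeriv ℝ k f) :=
  ((integrable_decayWeight hr).const_mul M).mono'
    (hf.contDiff.continuous_iteratedFDeriv (by exact_mod_cast hk)).aestronglyMeasurable
    (ae_of_all _ fun x => hf.norm_iteratedFDeriv_le hk x)

theorem HasDecay.integrable {F : Type*} [NormedAddCommGroup F] [NormedSpace ℝ F]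
    {r : ℕ} (hr : Module.finrank ℝ E < r) {f : E → F} {M : ℝ} (hf : HasDecay N r f M) :
    Integrable f :=
  ((integrable_decayWeight hr).const_mul M).mono' hf.contDiff.continuous.aestronglyMeasurable
    (ae_of_all _ fun x => by simpa using hf.norm_iteratedFDeriv_le (Nat.zero_le N) x)

theorem HasDecay.exists_norm_fourier_le {r : ℕ} (N : ℕ) (hr : Module.finrank ℝ E < r) :
    ∃ K : ℝ, 0 ≤ K ∧ ∀ (f : E → ℂ) (M : ℝ), HasDecay N r f M →
      ∀ x, ‖𝓕 f x‖ ≤ K * M * decayWeight N x := by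
  set I : ℝ := ∫ x : E, decayWeight r x
  have hI : 0 ≤ I := integral_nonneg fun x => (decayWeight_pos _ x).le
  refine ⟨2 ^ (N - 1) * (2 ^ 0 * I + 2 ^ N * ((N + 1) * I)), by positivity, fun f M hf x => ?_⟩
  have hM := hf.nonneg
  have hint : ∀ k ≤ N, ∫ v, ‖iteratedFDeriv ℝ k f v‖ ≤ M * I := fun k hk => by
    rw [← integral_const_mul]
    exact integral_mono (hf.integrable_iteratedFDeriv hr hk).norm
      ((integrable_decayWeight hr).const_mul M) fun v => hf.norm_iteratedFDeriv_le hk v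
  have hF : ∀ j ≤ N, ‖x‖ ^ j * ‖𝓕 f x‖ ≤ 2 ^ j * ((j + 1) * (M * I)) := fun j hj => by
    have h := Real.pow_mul_norm_iteratedFDeriv_fourier_le (K := 0) (N := (N : ℕ∞)) (f := f)
      (by exact_mod_cast hf.contDiff) (fun k i hk hi => by
        have hk0 : k = 0 := by simpa using hk
        simpa [hk0] using (hf.integrable_iteratedFDeriv hr (by exact_mod_cast hi)).norm)
      (k := 0) (n := j) le_rfl (by exact_mod_cast hj) x
    rw [norm_iteratedFDeriv_zero] at h
    refine h.trans ?_
    simp only [pow_zero, one_mul, Nat.cast_zero, mul_zero, zero_add]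
    refine mul_le_mul_of_nonneg_left ?_ (by positivity)
    calc _ ≤ ∑ p ∈ Finset.range 1 ×ˢ Finset.range (j + 1), M * I := by
          refine Finset.sum_le_sum fun p hp => ?_
          rw [Finset.mem_product, Finset.mem_range, Finset.mem_range] at hp
          obtain ⟨p₁, p₂⟩ := p
          obtain rfl : p₁ = 0 := by simpa using hp.1
          simpa using hint p₂ (by have := hp.2; simp only at this; omega)
      _ = (j + 1) * (M * I) := by simp
  rw [decayWeight, ← div_eq_mul_inv, le_div_iff₀ (by positivity)]
  calc ‖𝓕 f x‖ * (1 + ‖x‖) ^ N ≤ ‖𝓕 f x‖ * (2 ^ (N - 1) * (1 ^ N + ‖x‖ ^ N)) := by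
        gcongr
        exact add_pow_le zero_le_one (norm_nonneg x) N
    _ = 2 ^ (N - 1) * (‖x‖ ^ 0 * ‖𝓕 f x‖ + ‖x‖ ^ N * ‖𝓕 f x‖) := by
        simp only [one_pow, pow_zero]
        ring
    _ ≤ 2 ^ (N - 1) * (2 ^ 0 * (((0 : ℕ) + 1) * (M * I)) + 2 ^ N * ((N + 1) * (M * I))) := by
        exact mul_le_mul_of_nonneg_left
          (add_le_add (hF 0 (Nat.zero_le N)) (hF N le_rfl)) (by positivity)
    _ = _ := by
        push_cast
        ring

theorem exists_norm_scaledFourier_le {r : ℕ} (N : ℕ) (hr : Module.finrank ℝ E < r) (c : ℂ) {a : ℝ}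
    (ha : a ≠ 0) : ∃ K : ℝ, 0 ≤ K ∧ ∀ (f : E → ℂ) (M : ℝ), HasDecay N r f M →
      ∀ x, ‖scaledFourier c a f x‖ ≤ K * M * decayWeight N x := by
  obtain ⟨K, hK, h⟩ := HasDecay.exists_norm_fourier_le (E := E) N hr
  obtain ⟨A, hA, h'⟩ := exists_decayWeight_smul_le (E := E) N ha
  refine ⟨‖c‖ * K * A, by positivity, fun f M hf x => ?_⟩
  have hM := hf.nonneg
  rw [scaledFourier, norm_mul]
  calc ‖c‖ * ‖𝓕 f (a • x)‖ ≤ ‖c‖ * (K * M * (A * decayWeight N x)) := by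
        gcongr
        exact (h f M hf _).trans (mul_le_mul_of_nonneg_left (h' x) (by positivity))
    _ = _ := by ring

/-- The rescaled Fourier transform maps functions with sufficiently decaying derivatives up to
order `N > dim E` to `L_q`, with a bound. -/
theorem exists_memLp_scaledFourier {r : ℕ} (hN : Module.finrank ℝ E < N)
    (hr : Module.finrank ℝ E < r) (c : ℂ) {a : ℝ} (ha : a ≠ 0) {q : ℝ≥0∞} (hq : 1 ≤ q)
    (hq' : q ≠ ⊤) : ∃ K : ℝ, 0 ≤ K ∧ ∀ (f : E → ℂ) (M : ℝ), HasDecay N r f M →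
      ∃ h : MemLp (scaledFourier c a f) q, ‖h.toLp‖ ≤ K * M := by
  obtain ⟨K, hK, h⟩ := exists_norm_scaledFourier_le (E := E) N hr c ha
  have hw := memLp_decayWeight (E := E) hN hq hq'
  refine ⟨K * ‖hw.toLp‖, mul_nonneg hK ENNReal.toReal_nonneg, fun f M hf => ?_⟩
  have hM := hf.nonneg
  have hm : MemLp (scaledFourier c a f) q :=
    hw.of_le_mul (continuous_scaledFourier c a (hf.integrable hr)).aestronglyMeasurable
      (c := K * M) (ae_of_all _ fun x => by
        rw [Real.norm_of_nonneg (decayWeight_pos _ x).le]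
        exact h f M hf x)
  refine ⟨hm, ?_⟩
  have : ‖hm.toLp‖ ≤ K * M * ‖hw.toLp‖ := by
    refine Lp.norm_le_mul_norm_of_ae_le_mul ?_
    filter_upwards [hm.coeFn_toLp, hw.coeFn_toLp] with x h₁ h₂
    rw [h₁, h₂, Real.norm_of_nonneg (decayWeight_pos _ x).le]
    exact h f M hf x
  linarith

variable {m : E → ℝ} {q : ℝ≥0∞}

theorem HasPolyGrowth.integrable_smul_schwartz (hm : HasPolyGrowth N m) (ψ : 𝓢(E, ℂ)) :
    Integrable fun x => m x • ψ x := by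
  obtain ⟨_, _, _, h⟩ := hm.exists_hasDecay_smul_schwartz (Module.finrank ℝ E + 1)
  exact (h ψ).integrable (Nat.lt_succ_self _)

theorem HasPolyGrowth.memLp_scaledFourier (hm : HasPolyGrowth N m)
    (hN : Module.finrank ℝ E < N) (c : ℂ) {a : ℝ} (ha : a ≠ 0) (hq : 1 ≤ q) (hq' : q ≠ ⊤)
    (ψ : 𝓢(E, ℂ)) : MemLp (scaledFourier c a fun x => m x • ψ x) q := by
  obtain ⟨_, _, _, h⟩ := hm.exists_hasDecay_smul_schwartz (Module.finrank ℝ E + 1)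
  obtain ⟨_, _, h'⟩ := exists_memLp_scaledFourier (E := E) hN (Nat.lt_succ_self _) c ha hq hq'
  exact (h' _ _ (h ψ)).1

/-- The continuous linear map `ψ ↦ c 𝓕 (m ψ) (a ·)` from the Schwartz space to `L_q`. -/
def multiplierCLM (hm : HasPolyGrowth N m) (hN : Module.finrank ℝ E < N) (c : ℂ) {a : ℝ}
    (ha : a ≠ 0) [hq : Fact (1 ≤ q)] (hq' : q ≠ ⊤) :
    𝓢(E, ℂ) →L[ℂ] Lp ℂ q (volume : Measure E) :=
  SchwartzMap.mkCLMtoNormedSpace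
    (fun ψ => (hm.memLp_scaledFourier hN c ha hq.out hq' ψ).toLp)
    (fun f g => by
      rw [← MemLp.toLp_add]
      congr 1
      funext x
      simp only [add_apply, smul_add, Pi.add_apply]
      exact scaledFourier_add c a (hm.integrable_smul_schwartz f) (hm.integrable_smul_schwartz g) x)
    (fun z f => by
      rw [← MemLp.toLp_const_smul]
      congr 1
      funext x
      simp only [smul_apply, smul_eq_mul, Pi.smul_apply, RingHom.id_apply,
        ← scaledFourier_const_mul, mul_smul_comm])
    (by
      obtain ⟨s, C, hC, h⟩ := hm.exists_hasDecay_smul_schwartz (Module.finrank ℝ E + 1)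
      obtain ⟨K, hK, h'⟩ := exists_memLp_scaledFourier (E := E) hN (Nat.lt_succ_self _) c ha
        hq.out hq'
      refine ⟨s, K * C, by positivity, fun ψ => ?_⟩
      rw [mul_assoc]
      exact (h' _ _ (h ψ)).2)

theorem coeFn_multiplierCLM (hm : HasPolyGrowth N m) (hN : Module.finrank ℝ E < N) (c : ℂ) {a : ℝ}
    (ha : a ≠ 0) [hq : Fact (1 ≤ q)] (hq' : q ≠ ⊤) (ψ : 𝓢(E, ℂ)) :
    multiplierCLM hm hN c ha hq' ψ =ᵐ[volume] scaledFourier c a fun x => m x • ψ x :=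
  (hm.memLp_scaledFourier hN c ha hq.out hq' ψ).coeFn_toLp

/-- If test functions `h j` approximate `g ∈ C_c^N` uniformly with all derivatives up to order `N`
and are supported in a fixed ball, then `c 𝓕 (m h j) (a ·)` converges to `c 𝓕 (m g) (a ·)` in
`L_q`. -/
theorem tendsto_multiplierCLM (hm : HasPolyGrowth N m) (hN : Module.finrank ℝ E < N) (c : ℂ)
    {a : ℝ} (ha : a ≠ 0) [hq : Fact (1 ≤ q)] (hq' : q ≠ ⊤) {g : E → ℂ} (hg : ContDiff ℝ N g)
    {R : ℝ} (hR : 0 ≤ R) {h : ℕ → 𝓢(E, ℂ)} (hgR : tsupport g ⊆ Metric.closedBall 0 R)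
    (hhR : ∀ j, tsupport (h j) ⊆ Metric.closedBall 0 R)
    (hb : ∀ j, ∀ k ≤ N, ∀ x,
      ‖iteratedFDeriv ℝ k (fun y => h j y - g y) x‖ ≤ 1 / ((j : ℝ) + 1))
    {G : Lp ℂ q (volume : Measure E)} (hG : G =ᵐ[volume] scaledFourier c a fun x => m x • g x) :
    Tendsto (fun j => multiplierCLM hm hN c ha hq' (h j)) atTop (𝓝 G) := by
  obtain ⟨A, s, hA, hd⟩ := hm.exists_hasDecay_smul (F := ℂ) (Module.finrank ℝ E + 1)
  obtain ⟨K, hK, hK'⟩ := exists_memLp_scaledFourier (E := E) hN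
    (Nat.lt_succ_self (Module.finrank ℝ E)) c ha hq.out hq'
  rw [tendsto_iff_norm_sub_tendsto_zero]
  have hlim : Tendsto (fun j : ℕ => K * (A * ((1 + R) ^ s * (1 / ((j : ℝ) + 1))))) atTop (𝓝 0) := by
    simpa using (((tendsto_one_div_add_atTop_nhds_zero_nat.const_mul ((1 + R) ^ s)).const_mul
      A).const_mul K)
  refine squeeze_zero (fun _ => norm_nonneg _) (fun j => ?_) hlim
  have hdiff : HasDecay N s (fun y => h j y - g y) ((1 + R) ^ s * (1 / ((j : ℝ) + 1))) :=
    hasDecay_of_support_subset s hR (((h j).smooth N).sub hg)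
      ((tsupport_sub _ _).trans (Set.union_subset (hhR j) hgR)) (by positivity) (hb j)
  have hmd := hd _ _ hdiff
  obtain ⟨hmem, hn⟩ := hK' _ _ hmd
  have hi := hmd.integrable (Nat.lt_succ_self (Module.finrank ℝ E))
  have hih := hm.integrable_smul_schwartz (h j)
  have hig : Integrable fun x => m x • g x := by
    refine (hih.sub hi).congr (ae_of_all _ fun x => ?_)
    simp [mul_sub]
  have e : multiplierCLM hm hN c ha hq' (h j) - G = hmem.toLp := by
    ext1
    filter_upwards [Lp.coeFn_sub (multiplierCLM hm hN c ha hq' (h j)) G, hmem.coeFn_toLp, hG,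
      coeFn_multiplierCLM hm hN c ha hq' (h j)] with x h₁ h₂ h₃ h₄
    rw [h₁, h₂, Pi.sub_apply, h₃, h₄, sub_eq_iff_eq_add, ← scaledFourier_add c a hi hig]
    congr 1
    funext y
    simp [mul_sub]
  rw [e]
  exact hn

end ScaledFourier

variable {n : ℕ}

section Weights

theorem finrank_lt_two_mul_plus (n : ℕ) : Module.finrank ℝ (Rn n) < 2 * plus n := by
  rw [finrank_euclideanSpace_fin, plus]
  omega

theorem MemK.exists_inv_le {χ : Rn n → ℝ} (hχ : MemK χ) :
    ∃ (C : ℝ) (L : ℕ), 0 ≤ C ∧ ∀ x, (χ x)⁻¹ ≤ C * (1 + ‖x‖) ^ L := by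
  obtain ⟨C, hC, l, -, h⟩ := hχ.exists_bound
  have h0 := hχ.pos 0
  refine ⟨C / χ 0, ⌈l⌉₊, by positivity, fun x => ?_⟩
  have hx := hχ.pos x
  have h1 : χ 0 ≤ C * (1 + ‖x‖) ^ l * χ x := by simpa using h (-x) x
  have h2 : (1 + ‖x‖) ^ l ≤ (1 + ‖x‖) ^ ⌈l⌉₊ := by
    rw [← Real.rpow_natCast]
    exact Real.rpow_le_rpow_of_exponent_le (by linarith [norm_nonneg x]) (Nat.le_ceil l)
  have h3 : χ 0 ≤ C * (1 + ‖x‖) ^ ⌈l⌉₊ * χ x := h1.trans (by gcongr)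
  rw [inv_le_iff_one_le_mul₀ hx, div_mul_eq_mul_div, div_mul_eq_mul_div, le_div_iff₀ h0, one_mul]
  exact h3

theorem DerivBound.hasPolyGrowth {χ : Rn n → ℝ} (h : DerivBound χ)
    (hc : ContDiff ℝ (2 * plus n : ℕ) χ) : HasPolyGrowth (2 * plus n) χ := by
  obtain ⟨C, hC, l, hl, hb⟩ := h
  refine ⟨hc, C, ⌈l⌉₊, hC.le, fun k hk x => (hb k hk x).trans ?_⟩
  have h1 : Real.sqrt (1 + ‖x‖ ^ 2) ≤ 1 + ‖x‖ :=
    Real.sqrt_le_iff.2 ⟨by positivity, by nlinarith [norm_nonneg x]⟩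
  rw [← Real.rpow_natCast (1 + ‖x‖) ⌈l⌉₊]
  have h2 : Real.sqrt (1 + ‖x‖ ^ 2) ^ l ≤ (1 + ‖x‖) ^ l :=
    Real.rpow_le_rpow (Real.sqrt_nonneg _) h1 hl.le
  have h3 : (1 + ‖x‖) ^ l ≤ (1 + ‖x‖) ^ (⌈l⌉₊ : ℝ) :=
    Real.rpow_le_rpow_of_exponent_le (by linarith [norm_nonneg x]) (Nat.le_ceil l)
  exact mul_le_mul_of_nonneg_left (h2.trans h3) hC.le

variable {p : ℝ≥0∞} {χ : Rn n → ℝ}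

theorem Admissible.memK (hχ : Admissible p χ) : MemK χ := by
  rcases le_or_gt p 2 with hp | hp
  · exact (hχ.1 hp).toMemK
  · exact (hχ.2 hp).toMemK

theorem Admissible.hasPolyGrowth (hχ : Admissible p χ) : HasPolyGrowth (2 * plus n) χ := by
  rcases le_or_gt p 2 with hp | hp
  · exact (hχ.1 hp).derivBound.hasPolyGrowth (hχ.1 hp).contDiff
  · exact (hχ.2 hp).derivBound.hasPolyGrowth (contDiff_infty.1 (hχ.2 hp).contDiff _)

theorem Admissible.hasPolyGrowth_inv (hχ : Admissible p χ) :
    HasPolyGrowth (2 * plus n) fun x => (χ x)⁻¹ :=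
  hχ.hasPolyGrowth.inv hχ.memK.pos hχ.memK.exists_inv_le

end Weights

section Fourier

/-- The constant `(2π)⁻ⁿ`. -/
def invConst (n : ℕ) : ℂ := ((|((2 * Real.pi) ^ n)⁻¹| : ℝ) : ℂ)

theorem neg_inv_two_pi_ne_zero : (-(2 * Real.pi)⁻¹ : ℝ) ≠ 0 :=
  neg_ne_zero.2 (inv_ne_zero two_pi_ne_zero)

theorem fourierS_eq_scaledFourier (φ : 𝓢(Rn n, ℂ)) (x : Rn n) :
    fourierS n φ x = scaledFourier 1 (2 * Real.pi)⁻¹ φ x := by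
  have h : fourierS n φ x = (𝓕 φ : 𝓢(Rn n, ℂ)) ((2 * Real.pi)⁻¹ • x) := rfl
  rw [h, SchwartzMap.fourier_coe, scaledFourier, one_mul]

theorem fourierInvS_eq_scaledFourier (φ : 𝓢(Rn n, ℂ)) (x : Rn n) :
    fourierInvS n φ x = scaledFourier (invConst n) (-(2 * Real.pi)⁻¹) φ x := by
  have h : fourierInvS n φ x = 𝓕⁻ (fun v => φ ((2 * Real.pi) • v)) x := by
    change (𝓕⁻ (SchwartzMap.compCLMOfContinuousLinearEquiv ℂ
      (dilation n (2 * Real.pi) two_pi_ne_zero) φ) : 𝓢(Rn n, ℂ)) x = _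
    rw [SchwartzMap.fourierInv_coe]
    rfl
  rw [h, scaledFourier, Real.fourierInv_eq, Real.fourier_eq]
  have hs := Measure.integral_comp_smul (volume : Measure (Rn n))
    (fun v => Real.fourierChar (-inner ℝ v (-(2 * Real.pi)⁻¹ • x)) • φ v) (2 * Real.pi)
  rw [finrank_euclideanSpace_fin, Complex.real_smul] at hs
  rw [invConst, ← hs]
  refine integral_congr_ae (ae_of_all _ fun v => ?_)
  have e : (-inner ℝ ((2 * Real.pi) • v) (-(2 * Real.pi)⁻¹ • x) : ℝ) = inner ℝ v x := by
    rw [inner_smul_left, inner_smul_right]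
    have := two_pi_ne_zero
    simp only [conj_trivial]
    field_simp
  simp only [e]

theorem integral_fourierS_mul {f : Rn n → ℂ} (hf : Integrable f) (ψ : 𝓢(Rn n, ℂ)) :
    ∫ x, f x * fourierS n ψ x = ∫ x, scaledFourier 1 (2 * Real.pi)⁻¹ f x * ψ x := by
  simp only [fourierS_eq_scaledFourier]
  exact (integral_scaledFourier_mul _ _ hf ψ.integrable).symm

theorem integral_scaledFourier_mul_fourierS {f : Rn n → ℂ} (hf : Integrable f)
    (ψ : 𝓢(Rn n, ℂ)) :
    ∫ x, scaledFourier (invConst n) (-(2 * Real.pi)⁻¹) f x * fourierS n ψ x =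
      ∫ x, f x * ψ x := by
  rw [integral_scaledFourier_mul _ _ hf (fourierS n ψ).integrable]
  simp only [← fourierInvS_eq_scaledFourier, fourierInvS_fourierS]

theorem integrable_mul_schwartz {f : Rn n → ℂ} (hf : Integrable f) (ψ : 𝓢(Rn n, ℂ)) :
    Integrable fun x => f x * ψ x :=
  hf.mul_bdd (c := SchwartzMap.seminorm ℂ 0 0 ψ) ψ.continuous.aestronglyMeasurable
    (ae_of_all _ fun x => ψ.norm_le_seminorm ℂ x)

end Fourier

theorem inv_one_sub_inv_ne_top {p : ℝ≥0∞} (hp₁ : 1 < p) : (1 - p⁻¹)⁻¹ ≠ ⊤ := by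
  rw [ne_eq, ENNReal.inv_eq_top, tsub_eq_zero_iff_le, not_le]
  exact ENNReal.inv_lt_one.2 hp₁

variable {p : ℝ≥0∞} [Fact (1 ≤ p)] {χ : Rn n → ℝ}

section Inclusion

/-- The map `g ↦ F⁻¹ χ g` from the Schwartz space to `L_p`. -/
def weightedFourierInv (hp : p < ⊤) (hχ : Admissible p χ) :
    𝓢(Rn n, ℂ) →L[ℂ] Lp ℂ p (volume : Measure (Rn n)) :=
  multiplierCLM hχ.hasPolyGrowth (finrank_lt_two_mul_plus n) (invConst n) neg_inv_two_pi_ne_zero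
    hp.ne

theorem isFunction_fourierD_schwartz (φ : 𝓢(Rn n, ℂ)) :
    IsFunction (fourierD n (SchwartzMap.toTemperedDistributionCLM (Rn n) ℂ volume φ))
      (fourierS n φ) := by
  refine ⟨(fourierS n φ).continuous.measurable, fun ψ =>
    ⟨integrable_mul_schwartz (fourierS n φ).integrable ψ, ?_⟩⟩
  rw [fourierD_apply]
  refine (SchwartzMap.toTemperedDistributionCLM_apply_apply volume φ (fourierS n ψ)).trans ?_
  simp only [smul_eq_mul, mul_comm (fourierS n ψ _)]
  rw [integral_fourierS_mul φ.integrable]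
  simp only [fourierS_eq_scaledFourier]

theorem isFunction_fourierD_weightedFourierInv (hp : p < ⊤) (hχ : Admissible p χ)
    (g : 𝓢(Rn n, ℂ)) :
    IsFunction (fourierD n (Lp.toTemperedDistribution (weightedFourierInv hp hχ g)))
      (fun x => (χ x : ℂ) * g x) := by
  have hi : Integrable fun x => (χ x : ℂ) * g x := hχ.hasPolyGrowth.integrable_smul_schwartz g
  refine ⟨(Complex.measurable_ofReal.comp hχ.memK.measurable).mul g.continuous.measurable, fun ψ =>
    ⟨integrable_mul_schwartz hi ψ, ?_⟩⟩
  rw [fourierD_apply, Lp.toTemperedDistribution_apply, ← integral_scaledFourier_mul_fourierS hi]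
  refine integral_congr_ae ?_
  filter_upwards [coeFn_multiplierCLM hχ.hasPolyGrowth (finrank_lt_two_mul_plus n) (invConst n)
    neg_inv_two_pi_ne_zero hp.ne g] with x hx
  rw [weightedFourierInv, hx, smul_eq_mul, mul_comm]
  rfl

theorem fourierInvD_fourierD (u : 𝓢'(Rn n, ℂ)) : fourierInvD n (fourierD n u) = u := by
  ext φ
  rw [fourierInvD_apply, fourierD_apply, fourierS_fourierInvS]

theorem isImage_schwartz (hp : p < ⊤) (hχ : Admissible p χ) (φ : 𝓢(Rn n, ℂ)) :
    IsImage p χ (SchwartzMap.toTemperedDistributionCLM (Rn n) ℂ volume φ)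
      (weightedFourierInv hp hχ (fourierS n φ)) := by
  have hT := isFunction_fourierD_schwartz φ
  have hS := isFunction_fourierD_weightedFourierInv hp hχ (fourierS n φ)
  refine ⟨_, ⟨fun _ => ⟨_, hT, hS⟩, fun _ ψ ψ' h => ?_⟩, fourierInvD_fourierD _⟩
  rw [(hS.2 ψ).2, (hT.2 ψ').2]
  refine integral_congr_ae (ae_of_all _ fun x => ?_)
  simp only [h]
  ring

/-- The inclusion `𝓢 → H^χ_p`. -/
def schwartzInclusion (hp : p < ⊤) (hχ : Admissible p χ) :
    𝓢(Rn n, ℂ) →ₗ[ℂ] HSpace n p χ hχ :=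
  LinearMap.codRestrict (HSubmodule n p χ)
    (SchwartzMap.toTemperedDistributionCLM (Rn n) ℂ volume).toLinearMap
    fun φ => ⟨_, isImage_schwartz hp hχ φ⟩

theorem toDistribution_schwartzInclusion (hp : p < ⊤) (hχ : Admissible p χ) (φ : 𝓢(Rn n, ℂ)) :
    (schwartzInclusion hp hχ φ).toDistribution =
      SchwartzMap.toTemperedDistributionCLM (Rn n) ℂ volume φ := rfl

theorem image_schwartzInclusion (hp : p < ⊤) (hχ : Admissible p χ) (φ : 𝓢(Rn n, ℂ)) :
    HSpace.image (schwartzInclusion hp hχ φ) = weightedFourierInv hp hχ (fourierS n φ) :=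
  (HSpace.isImage_image _).unique hχ (isImage_schwartz hp hχ φ)

theorem HSpace.isInducing_image {hχ : Admissible p χ} :
    IsInducing (HSpace.image : HSpace n p χ hχ → Lp ℂ p (volume : Measure (Rn n))) := ⟨rfl⟩

theorem continuous_schwartzInclusion (hp : p < ⊤) (hχ : Admissible p χ) :
    Continuous (schwartzInclusion hp hχ) := by
  rw [HSpace.isInducing_image.continuous_iff]
  exact ((weightedFourierInv hp hχ).continuous.comp (fourierS n).continuous).congr fun φ =>
    (image_schwartzInclusion hp hχ φ).symm

theorem injective_toTemperedDistributionCLM :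
    Function.Injective (SchwartzMap.toTemperedDistributionCLM (Rn n) ℂ volume) := by
  intro f g h
  have : Fact ((1 : ℝ≥0∞) ≤ 1) := ⟨le_rfl⟩
  refine SchwartzMap.injective_toLp 1 volume ?_
  have hk := Lp.ker_toTemperedDistributionCLM_eq_bot (F := ℂ) (μ := (volume : Measure (Rn n)))
    (p := 1)
  refine LinearMap.ker_eq_bot.1 hk ?_
  change Lp.toTemperedDistribution (f.toLp 1 volume) = Lp.toTemperedDistribution (g.toLp 1 volume)
  rw [Lp.toTemperedDistribution_toLp_eq, Lp.toTemperedDistribution_toLp_eq, h]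

theorem toLp_fourierInvS_mem_closure (hp : p < ⊤) (hχ : Admissible p χ) {h : 𝓢(Rn n, ℂ)}
    (hh : HasCompactSupport h) :
    (fourierInvS n h).toLp p volume ∈ closure (Set.range (weightedFourierInv hp hχ)) := by
  have hg : ContDiff ℝ (2 * plus n : ℕ) fun x => (χ x)⁻¹ • h x :=
    hχ.hasPolyGrowth_inv.contDiff.smul (h.smooth _)
  obtain ⟨R, f, hR, hgR, hfR, hb⟩ := exists_schwartz_approx
    (hh.smul_left (f := fun x => (χ x)⁻¹)) hg
  refine mem_closure_of_tendsto (tendsto_multiplierCLM hχ.hasPolyGrowth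
    (finrank_lt_two_mul_plus n) (invConst n) neg_inv_two_pi_ne_zero hp.ne hg hR hgR hfR hb ?_)
    (Eventually.of_forall fun j => Set.mem_range_self (f j))
  filter_upwards [(fourierInvS n h).coeFn_toLp p volume] with x hx
  rw [hx, fourierInvS_eq_scaledFourier]
  congr 1
  funext y
  rw [smul_smul, mul_inv_cancel₀ (hχ.memK.pos y).ne', one_smul]

theorem denseRange_weightedFourierInv (hp : p < ⊤) (hχ : Admissible p χ) :
    DenseRange (weightedFourierInv hp hχ) := by
  have hd := SchwartzMap.denseRange_toLpCLM (E := Rn n) (F := ℂ) (p := p) hp.ne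
    (μ := (volume : Measure (Rn n)))
  refine dense_closure.1 (hd.mono ?_)
  rintro _ ⟨w, rfl⟩
  obtain ⟨h, hc, hlim⟩ := exists_tendsto_hasCompactSupport (fourierS n w)
  have hlim' := (((SchwartzMap.toLpCLM ℂ ℂ p (volume : Measure (Rn n))).continuous.comp
    (fourierInvS n).continuous).tendsto _).comp hlim
  have e : (SchwartzMap.toLpCLM ℂ ℂ p (volume : Measure (Rn n)) ∘ fourierInvS n) (fourierS n w) =
      SchwartzMap.toLpCLM ℝ ℂ p (volume : Measure (Rn n)) w := by
    simp [fourierInvS_fourierS]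
  rw [e] at hlim'
  exact isClosed_closure.mem_of_tendsto hlim'
    (Eventually.of_forall fun j => toLp_fourierInvS_mem_closure hp hχ (hc j))

theorem denseRange_schwartzInclusion (hp : p < ⊤) (hχ : Admissible p χ) :
    DenseRange (schwartzInclusion hp hχ) := by
  intro u
  rw [HSpace.isInducing_image.closure_eq_preimage_closure_image, Set.mem_preimage]
  have : HSpace.image '' Set.range (schwartzInclusion hp hχ) =
      Set.range (weightedFourierInv hp hχ) := by
    ext v
    constructor
    · rintro ⟨_, ⟨φ, rfl⟩, rfl⟩
      exact ⟨fourierS n φ, (image_schwartzInclusion hp hχ φ).symm⟩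
    · rintro ⟨g, rfl⟩
      exact ⟨_, ⟨fourierInvS n g, rfl⟩, by rw [image_schwartzInclusion, fourierS_fourierInvS]⟩
  rw [this]
  exact denseRange_weightedFourierInv hp hχ _

end Inclusion

section Distribution

variable {q : ℝ≥0∞} [Fact (1 ≤ q)] [p.HolderConjugate q]

/-- The pairing `(v, w) ↦ ∫ v w` of `L_p` and `L_q`. -/
def lpDual (n : ℕ) (p q : ℝ≥0∞) [Fact (1 ≤ p)] [Fact (1 ≤ q)] [p.HolderConjugate q] :
    Lp ℂ p (volume : Measure (Rn n)) →L[ℂ] Lp ℂ q (volume : Measure (Rn n)) →L[ℂ] ℂ :=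
  (ContinuousLinearMap.mul ℂ ℂ).lpPairing volume p q

theorem lpDual_apply (v : Lp ℂ p (volume : Measure (Rn n)))
    (w : Lp ℂ q (volume : Measure (Rn n))) : lpDual n p q v w = ∫ x, v x * w x := by
  rw [lpDual, ContinuousLinearMap.lpPairing_eq_integral]
  rfl

/-- The map `ψ ↦ F ψ` from the Schwartz space to `L_q`. -/
def fourierLp (n : ℕ) (hq : q ≠ ⊤) : 𝓢(Rn n, ℂ) →L[ℂ] Lp ℂ q (volume : Measure (Rn n)) :=
  multiplierCLM (hasPolyGrowth_const (2 * plus n) (1 : ℝ)) (finrank_lt_two_mul_plus n) 1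
    (inv_ne_zero two_pi_ne_zero) hq

/-- The map `ψ ↦ F χ⁻¹ ψ` from the Schwartz space to `L_q`. -/
def invWeightedFourier (hχ : Admissible p χ) (hq : q ≠ ⊤) :
    𝓢(Rn n, ℂ) →L[ℂ] Lp ℂ q (volume : Measure (Rn n)) :=
  multiplierCLM hχ.hasPolyGrowth_inv (finrank_lt_two_mul_plus n) 1
    (inv_ne_zero two_pi_ne_zero) hq

theorem coeFn_fourierLp (hq : q ≠ ⊤) (ψ : 𝓢(Rn n, ℂ)) :
    fourierLp n hq ψ =ᵐ[volume] fourierS n ψ := by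
  filter_upwards [coeFn_multiplierCLM (hasPolyGrowth_const (2 * plus n) (1 : ℝ))
    (finrank_lt_two_mul_plus n) 1 (inv_ne_zero two_pi_ne_zero) hq ψ] with x hx
  rw [fourierLp, hx, fourierS_eq_scaledFourier]
  simp only [one_smul]

theorem apply_eq_lpDual_of_fourierInvD_eq (hq : q ≠ ⊤) {S : 𝓢'(Rn n, ℂ)}
    {v : Lp ℂ p (volume : Measure (Rn n))}
    (h : fourierInvD n S = Lp.toTemperedDistribution v) (ψ : 𝓢(Rn n, ℂ)) :
    S ψ = lpDual n p q v (fourierLp n hq ψ) := by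
  have := congrArg (fun T : 𝓢'(Rn n, ℂ) => T (fourierS n ψ)) h
  simp only [fourierInvD_apply, fourierInvS_fourierS, Lp.toTemperedDistribution_apply] at this
  rw [this, lpDual_apply]
  refine integral_congr_ae ?_
  filter_upwards [coeFn_fourierLp hq ψ] with x hx
  rw [hx, smul_eq_mul, mul_comm]

/-- Integration against a function which is a tempered distribution is continuous along uniformly
convergent sequences of functions supported in a fixed ball. -/
theorem tendsto_integral_of_isFunction {S : 𝓢'(Rn n, ℂ)} {f : Rn n → ℂ} (hS : IsFunction S f)
    {g : Rn n → ℂ} (hg : Continuous g) {R : ℝ} {h : ℕ → 𝓢(Rn n, ℂ)}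
    (hgR : tsupport g ⊆ Metric.closedBall 0 R)
    (hhR : ∀ j, tsupport (h j) ⊆ Metric.closedBall 0 R)
    (hb : ∀ j, ∀ x, ‖h j x - g x‖ ≤ 1 / ((j : ℝ) + 1)) :
    Tendsto (fun j => S (h j)) atTop (𝓝 (∫ x, f x * g x)) := by
  have hc : HasCompactSupport g :=
    (isCompact_closedBall (0 : Rn n) R).of_isClosed_subset (isClosed_tsupport g) hgR
  obtain ⟨B, hB⟩ := hc.exists_bound_of_continuous hg
  let b : ContDiffBump (0 : Rn n) :=
    ⟨max R 0 + 1, max R 0 + 2, by positivity, by linarith⟩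
  have hbc : HasCompactSupport (Complex.ofRealCLM ∘ b) := b.hasCompactSupport.comp_left rfl
  have hbs : ContDiff ℝ ∞ (Complex.ofRealCLM ∘ b) :=
    Complex.ofRealCLM.contDiff.comp b.contDiff
  let β : 𝓢(Rn n, ℂ) := hbc.toSchwartzMap hbs
  have hβ : ∀ x ∈ Metric.closedBall (0 : Rn n) R, β x = 1 := fun x hx => by
    have : b x = 1 := b.one_of_mem_closedBall
      (Metric.closedBall_subset_closedBall (by linarith [le_max_left R 0]) hx)
    change ((b x : ℝ) : ℂ) = 1
    rw [this, Complex.ofReal_one]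
  simp only [(hS.2 _).2]
  refine tendsto_integral_of_dominated_convergence (fun x => ‖f x * β x‖ * (B + 1))
    (fun j => (hS.2 (h j)).1.aestronglyMeasurable) ((hS.2 β).1.norm.mul_const _)
    (fun j => ae_of_all _ fun x => ?_) (ae_of_all _ fun x => ?_)
  · by_cases hx : x ∈ Metric.closedBall (0 : Rn n) R
    · rw [hβ x hx, mul_one, norm_mul]
      refine mul_le_mul_of_nonneg_left ?_ (norm_nonneg _)
      have h1 : 1 / ((j : ℝ) + 1) ≤ 1 := by
        rw [div_le_one (by positivity)]
        linarith [j.cast_nonneg (α := ℝ)]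
      calc ‖h j x‖ = ‖g x + (h j x - g x)‖ := by congr 1; ring
        _ ≤ ‖g x‖ + ‖h j x - g x‖ := norm_add_le _ _
        _ ≤ B + 1 := add_le_add (hB x) ((hb j x).trans h1)
    · have : h j x = 0 := image_eq_zero_of_notMem_tsupport fun hx' => hx (hhR j hx')
      rw [this, mul_zero, norm_zero]
      exact mul_nonneg (norm_nonneg _) (by linarith [norm_nonneg (g x), hB x])
  · refine Tendsto.const_mul _ ?_
    rw [tendsto_iff_norm_sub_tendsto_zero]
    exact squeeze_zero (fun _ => norm_nonneg _) (fun j => hb j x)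
      tendsto_one_div_add_atTop_nhds_zero_nat

theorem IsProduct.apply_eq_lpDual_of_hasCompactSupport (hχ : Admissible p χ) (hq : q ≠ ⊤)
    {T S : 𝓢'(Rn n, ℂ)} (hTS : IsProduct p χ T S) {v : Lp ℂ p (volume : Measure (Rn n))}
    (h : fourierInvD n S = Lp.toTemperedDistribution v) {ψ : 𝓢(Rn n, ℂ)}
    (hψ : HasCompactSupport ψ) :
    T ψ = lpDual n p q v (invWeightedFourier hχ hq ψ) := by
  have hmul : ∀ x, (χ x : ℂ) * ((χ x)⁻¹ • ψ x) = ψ x := fun x => by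
    rw [← Complex.real_smul, smul_smul, mul_inv_cancel₀ (hχ.memK.pos x).ne', one_smul]
  rcases le_or_gt p 2 with hp | hp
  · obtain ⟨f, hT, hS⟩ := hTS.1 hp
    have hg : ContDiff ℝ (2 * plus n : ℕ) fun x => (χ x)⁻¹ • ψ x :=
      hχ.hasPolyGrowth_inv.contDiff.smul (ψ.smooth _)
    obtain ⟨R, g, hR, hgR, hfR, hb⟩ := exists_schwartz_approx
      (hψ.smul_left (f := fun x => (χ x)⁻¹)) hg
    have h₁ := tendsto_integral_of_isFunction hS hg.continuous hgR hfR
      (fun j x => by simpa using hb j 0 (Nat.zero_le _) x)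
    have h₂ : Tendsto (fun j => fourierLp n hq (g j)) atTop (𝓝 (invWeightedFourier hχ hq ψ)) := by
      refine tendsto_multiplierCLM _ _ _ _ hq hg hR hgR hfR hb ?_
      simp only [one_smul]
      exact coeFn_multiplierCLM hχ.hasPolyGrowth_inv (finrank_lt_two_mul_plus n) 1
        (inv_ne_zero two_pi_ne_zero) hq ψ
    have h₃ := ((lpDual n p q v).continuous.tendsto _).comp h₂
    simp only [apply_eq_lpDual_of_fourierInvD_eq hq h] at h₁
    rw [← tendsto_nhds_unique h₁ h₃, (hT.2 ψ).2]
    refine integral_congr_ae (ae_of_all _ fun x => ?_)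
    simp only [mul_right_comm _ (f x), hmul x, mul_comm (f x)]
  · have hs : ContDiff ℝ ∞ fun x => (χ x)⁻¹ • ψ x :=
      ((hχ.2 hp).contDiff.inv fun x => (hχ.memK.pos x).ne').smul (ψ.smooth _)
    let g : 𝓢(Rn n, ℂ) := (hψ.smul_left (f := fun x => (χ x)⁻¹)).toSchwartzMap hs
    have hgx : ∀ x, g x = (χ x)⁻¹ • ψ x := fun x => rfl
    rw [← hTS.2 hp g ψ fun x => by rw [hgx, hmul], apply_eq_lpDual_of_fourierInvD_eq hq h]
    congr 1
    ext1
    refine (coeFn_multiplierCLM _ _ _ _ hq g).trans ?_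
    simp only [one_smul]
    exact (coeFn_multiplierCLM _ _ _ _ hq ψ).symm

theorem IsImage.apply_eq_lpDual (hχ : Admissible p χ) (hq : q ≠ ⊤) {u : 𝓢'(Rn n, ℂ)}
    {v : Lp ℂ p (volume : Measure (Rn n))} (h : IsImage p χ u v) (φ : 𝓢(Rn n, ℂ)) :
    u φ = lpDual n p q v (invWeightedFourier hχ hq (fourierInvS n φ)) := by
  obtain ⟨S, hTS, hS⟩ := h
  obtain ⟨g, hc, hlim⟩ := exists_tendsto_hasCompactSupport (fourierInvS n φ)
  have h₁ := ((fourierD n u).continuous.tendsto _).comp hlim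
  have h₂ := (((lpDual n p q v).continuous.comp
    (invWeightedFourier hχ hq).continuous).tendsto _).comp hlim
  have h₃ : fourierD n u (fourierInvS n φ) = u φ := by
    rw [fourierD_apply, fourierS_fourierInvS]
  rw [← h₃]
  refine tendsto_nhds_unique h₁ (h₂.congr fun j => ?_)
  exact (hTS.apply_eq_lpDual_of_hasCompactSupport hχ hq hS (hc j)).symm

theorem continuous_toDistribution (hp₁ : 1 < p) (hχ : Admissible p χ) :
    Continuous (HSpace.toDistribution (hχ := hχ)) := by
  let q : ℝ≥0∞ := (1 - p⁻¹)⁻¹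
  have hpq : p.HolderConjugate q := ENNReal.HolderConjugate.inv_one_sub_inv' hp₁.le
  have hq₁ : Fact (1 ≤ q) := ⟨by simp [q]⟩
  have hq : q ≠ ⊤ := inv_one_sub_inv_ne_top hp₁
  refine PointwiseConvergenceCLM.continuous_of_continuous_eval fun φ => ?_
  have hc : Continuous fun u : HSpace n p χ hχ =>
      (lpDual n p q).flip (invWeightedFourier hχ hq (fourierInvS n φ)) (HSpace.image u) :=
    (ContinuousLinearMap.continuous _).comp HSpace.isInducing_image.continuous
  exact hc.congr fun u => ((HSpace.isImage_image u).apply_eq_lpDual hχ hq φ).symm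

end Distribution

end GenSobolev

end

/-- Both inclusions `𝓢 ⊂ H^χ_p ⊂ 𝓢'` hold, they are continuous, and `𝓢` is dense in `H^χ_p`. -/
theorem proposition2p5 {n : ℕ} {p : ℝ≥0∞} [Fact (1 ≤ p)] (hp₁ : 1 < p) (hp : p < ⊤)
    (χ : GenSobolev.Rn n → ℝ) (hχ : GenSobolev.Admissible p χ) :
    (∃ ι : 𝓢(GenSobolev.Rn n, ℂ) →L[ℂ] GenSobolev.HSpace n p χ hχ,
      (∀ φ, (ι φ).toDistribution =
        SchwartzMap.toTemperedDistributionCLM (GenSobolev.Rn n) ℂ volume φ) ∧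
      Function.Injective ι ∧ DenseRange ι) ∧
    Function.Injective (GenSobolev.HSpace.toDistribution (hχ := hχ)) ∧
    Continuous (GenSobolev.HSpace.toDistribution (hχ := hχ)) := by
  refine ⟨⟨⟨GenSobolev.schwartzInclusion hp hχ, GenSobolev.continuous_schwartzInclusion hp hχ⟩,
    GenSobolev.toDistribution_schwartzInclusion hp hχ, fun φ ψ h => ?_,
    GenSobolev.denseRange_schwartzInclusion hp hχ⟩, Subtype.val_injective,
    GenSobolev.continuous_toDistribution hp₁ hχ⟩
  exact GenSobolev.injective_toTemperedDistributionCLM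
    (congrArg GenSobolev.HSpace.toDistribution h)
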